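/- Let $L^2=L^2(\mathbb T,m)$, where $m$ is normalized Lebesgue measure on the unit circle $\mathbb T$, and let $H^2\subset L^2$ be the Hardy space of the unit disc $\mathbb D$, identified with the functions in $L^2$ whose Fourier coefficients of negative index vanish. For an inner function $\theta$ let $K_\theta=H^2\ominus\theta H^2$ be the model space, $P_\theta\colon L^2\to K_\theta$ the orthogonal projection, and $C_\theta f=\theta\,\bar z\,\bar f$ the associated conjugation of $K_\theta$. For inner functions $\theta,\alpha$ and $\varphi\in L^2$ let $A^{\theta,\alpha}_\varphi f=P_\alpha(\varphi f)$, defined for all $f\in K_\theta$ with $\varphi f\in L^2$. If this operator is bounded, $A^{\theta,\alpha}_\varphi$ also denotes its unique bounded extension $K_\theta\to K_\alpha$; $\mathcal T(\theta,\alpha)$ is the set of all operators obtained in this way. Let $\alpha$ and $\theta$ be nonconstant inner functions such that $\alpha$ divides $\theta$, i.e. $\frac\theta\alpha$ is an inner function, and assume that $\frac\theta\alpha$ is nonconstant. Then $K_\theta=K_\alpha\oplus\alpha K_{\frac\theta\alpha}$, and $C_{\alpha,\frac\theta\alpha}(g_1+\alpha g_2)=C_\alpha g_1+\alpha\, C_{\frac\theta\alpha}g_2$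 (for $g_1\in K_\alpha$, $g_2\in K_{\frac\theta\alpha}$) defines a conjugation of $K_\theta$. Let $A\in\mathcal T(\theta,\alpha)$. Then, with equalities of maps on $K_\theta$: 1. $A\,C_\theta=C_\theta A^*P_\alpha$ if and only if there is $\varphi\in\overline{\frac\theta\alpha K_\alpha}=\{\overline{\frac\theta\alpha k}: k\in K_\alpha\}$ such that $A=A^{\theta,\alpha}_\varphi$; 2. $A\,C_{\alpha,\frac\theta\alpha}=C_{\alpha,\frac\theta\alpha}A^*P_\alpha$ if and only if there is $\varphi\in K_\alpha$ such that $A=A^{\theta,\alpha}_\varphi$. -/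

import Mathlib

open MeasureTheory Filter Topology
open scoped ENNReal Real ComplexConjugate InnerProductSpace

noncomputable section

namespace ATTO

instance instFactTwoPiPos : Fact (0 < 2 * π) := ⟨Real.two_pi_pos⟩

/-- The unit circle, parametrized by `t ↦ exp (i t)` (`AddCircle.toCircle`), `t ∈ ℝ / 2πℤ`. -/
abbrev Torus : Type := AddCircle (2 * π)

/-- Normalized Lebesgue measure on the circle. -/
abbrev m : Measure Torus := AddCircle.haarAddCircle

/-- The space `L²` of the circle. -/
abbrev L2 : Type := Lp ℂ 2 m

/-- The space `L^∞` of the circle. -/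
abbrev Linf : Type := Lp ℂ ∞ m

/-- An inner function: bounded and analytic in the open unit disc, with radial limits of modulus
one at almost every point of the unit circle. (The values outside the disc are irrelevant.) -/
structure InnerFunction where
  toFun : ℂ → ℂ
  differentiableOn : DifferentiableOn ℂ toFun (Metric.ball 0 1)
  bounded : ∃ M : ℝ, ∀ w ∈ Metric.ball (0 : ℂ) 1, ‖toFun w‖ ≤ M
  boundary : ∀ᵐ t ∂m, ∃ w : ℂ, ‖w‖ = 1 ∧
    Tendsto (fun r : ℝ => toFun (r * (AddCircle.toCircle t : ℂ))) (𝓝[<] 1) (𝓝 w)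

/-- An inner function is nonconstant if it is nonconstant in the unit disc. -/
def InnerFunction.Nonconstant (θ : InnerFunction) : Prop :=
  ∃ w₁ ∈ Metric.ball (0 : ℂ) 1, ∃ w₂ ∈ Metric.ball (0 : ℂ) 1, θ.toFun w₁ ≠ θ.toFun w₂

/-- `IsQuotient θ α β`: the inner function `β` is `θ / α`, i.e. `θ = α β` in the unit disc. -/
def IsQuotient (θ α β : InnerFunction) : Prop :=
  ∀ w ∈ Metric.ball (0 : ℂ) 1, θ.toFun w = α.toFun w * β.toFun w

/-- The boundary function (radial limit) of an inner function. -/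
def bdFun (θ : InnerFunction) (t : Torus) : ℂ :=
  limUnder (𝓝[<] (1 : ℝ)) (fun r : ℝ => θ.toFun (r * (AddCircle.toCircle t : ℂ)))

lemma bdFun_tendsto (θ : InnerFunction) : ∀ᵐ t ∂m,
    Tendsto (fun r : ℝ => θ.toFun (r * (AddCircle.toCircle t : ℂ))) (𝓝[<] 1) (𝓝 (bdFun θ t)) := by
  filter_upwards [θ.boundary] with t ⟨w, _, hw⟩
  exact tendsto_nhds_limUnder ⟨w, hw⟩

lemma norm_bdFun (θ : InnerFunction) : ∀ᵐ t ∂m, ‖bdFun θ t‖ = 1 := by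
  filter_upwards [θ.boundary] with t ⟨w, h1, hw⟩
  have : bdFun θ t = w := hw.limUnder_eq
  rw [this, h1]

/-- Radii increasing to `1`. -/
def rad (n : ℕ) : ℝ := 1 - 1 / ((n : ℝ) + 2)

lemma rad_pos (n : ℕ) : 0 < rad n := by
  unfold rad
  rw [sub_pos, div_lt_one (by positivity)]
  have : (0 : ℝ) ≤ n := n.cast_nonneg
  linarith

lemma rad_lt (n : ℕ) : rad n < 1 := by
  unfold rad
  have : 0 < 1 / ((n : ℝ) + 2) := by positivity
  linarith

lemma rad_tendsto : Tendsto rad atTop (𝓝[<] 1) := by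
  refine tendsto_nhdsWithin_iff.2 ⟨?_, Eventually.of_forall rad_lt⟩
  have h : Tendsto (fun n : ℕ => 1 / ((n : ℝ) + 2)) atTop (𝓝 0) := by
    have := (tendsto_one_div_add_atTop_nhds_zero_nat (𝕜 := ℝ)).comp (tendsto_add_atTop_nat 1)
    refine this.congr fun n => ?_
    simp only [Function.comp_apply]
    push_cast
    ring
  have h2 := (tendsto_const_nhds (x := (1 : ℝ))).sub h
  rw [sub_zero] at h2
  exact h2

lemma rad_mem (n : ℕ) (t : Torus) :
    (rad n : ℂ) * (AddCircle.toCircle t : ℂ) ∈ Metric.ball (0 : ℂ) 1 := by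
  rw [mem_ball_zero_iff, norm_mul, Circle.norm_coe, mul_one, Complex.norm_real, Real.norm_eq_abs,
    abs_of_pos (rad_pos n)]
  exact rad_lt n

lemma continuous_rad (θ : InnerFunction) (n : ℕ) :
    Continuous (fun t : Torus => θ.toFun (rad n * (AddCircle.toCircle t : ℂ))) := by
  have h := AddCircle.continuous_toCircle (T := 2 * π)
  exact θ.differentiableOn.continuousOn.comp_continuous
    (continuous_const.mul (continuous_subtype_val.comp h)) (rad_mem n)

lemma aestronglyMeasurable_bdFun (θ : InnerFunction) : AEStronglyMeasurable (bdFun θ) m := by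
  refine aestronglyMeasurable_of_tendsto_ae atTop
    (f := fun n t => θ.toFun (rad n * (AddCircle.toCircle t : ℂ)))
    (fun n => (continuous_rad θ n).aestronglyMeasurable) ?_
  filter_upwards [bdFun_tendsto θ] with t ht
  exact ht.comp rad_tendsto

lemma memLp_bdFun (θ : InnerFunction) : MemLp (bdFun θ) ∞ m :=
  memLp_top_of_bound (aestronglyMeasurable_bdFun θ) 1
    ((norm_bdFun θ).mono fun _ h => h.le)

/-- The boundary function of an inner function as an element of `L^∞`. Multiplication of an
`L²` function `f` by it is written `bd θ • f`. -/
def bd (θ : InnerFunction) : Linf := (memLp_bdFun θ).toLp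

/-- The function `z̄` on the circle. -/
def zbar : Linf := fourierLp ∞ (-1)

/-- The Hardy space `H²`, as the subspace of `L²` of all functions whose Fourier coefficients of
negative index vanish. -/
def H2 : Submodule ℂ L2 where
  carrier := {f | ∀ n : ℤ, n < 0 → fourierCoeff (f : Torus → ℂ) n = 0}
  zero_mem' := fun n _ => by rw [← fourierBasis_repr, map_zero]; rfl
  add_mem' := fun {f g} hf hg n hn => by
    have hf := hf n hn
    have hg := hg n hn
    simp only [← fourierBasis_repr] at hf hg ⊢
    simp [hf, hg]
  smul_mem' := fun c f hf n hn => by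
    have hf := hf n hn
    simp only [← fourierBasis_repr] at hf ⊢
    simp [hf]

/-- Multiplication by a bounded function on `L²`. -/
def mulBy (u : Linf) : L2 →ₗ[ℂ] L2 where
  toFun f := u • f
  map_add' f g := Lp.add_smul u f g
  map_smul' c f := (Lp.smul_comm c u f).symm

/-- The model space `K_θ = H² ⊖ θ H²`. -/
def K (θ : InnerFunction) : Submodule ℂ L2 := H2 ⊓ (H2.map (mulBy (bd θ)))ᗮ

lemma isClosed_H2 : IsClosed (H2 : Set L2) := by
  have : (H2 : Set L2) = ⋂ n : ℤ, ⋂ _ : n < 0, {f | ⟪fourierLp 2 n, f⟫_ℂ = 0} := by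
    ext f
    simp only [SetLike.mem_coe, Set.mem_iInter, Set.mem_ofPred_eq]
    refine forall_congr' fun n => forall_congr' fun _ => ?_
    rw [← fourierBasis_repr, HilbertBasis.repr_apply_apply, coe_fourierBasis]
  rw [this]
  exact isClosed_iInter fun n => isClosed_iInter fun _ =>
    isClosed_eq (continuous_const.inner continuous_id) continuous_const

instance instCompleteK (θ : InnerFunction) : CompleteSpace (K θ) :=
  (isClosed_H2.inter (Submodule.isClosed_orthogonal _)).completeSpace_coe

/-- The orthogonal projection `P_θ` of `L²` onto the model space `K_θ`. -/
def P (θ : InnerFunction) : L2 →L[ℂ] K θ := (K θ).orthogonalProjectionOnto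

/-- `A = A_φ^{θ,α}`: the bounded operator `A` from `K_θ` to `K_α` is given by `A f = P_α (φ f)` for
every `f ∈ K_θ` such that `φ f ∈ L²`. -/
def IsATTO (θ α : InnerFunction) (φ : L2) (A : K θ →L[ℂ] K α) : Prop :=
  ∀ (f : K θ) (hf : MemLp (fun t => φ t * (f : L2) t) 2 m), A f = P α hf.toLp

/-- The class `𝒯(θ,α)` of bounded asymmetric truncated Toeplitz operators from `K_θ` to `K_α`. -/
def ATTOs (θ α : InnerFunction) : Set (K θ →L[ℂ] K α) := {A | ∃ φ : L2, IsATTO θ α φ A}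

/-! ### Facts needed to define the conjugations on the model spaces -/

lemma mem_H2_iff (f : L2) : f ∈ H2 ↔ ∀ n : ℤ, n < 0 → ⟪fourierLp 2 n, f⟫_ℂ = 0 := by
  refine forall_congr' fun n => forall_congr' fun _ => ?_
  rw [← fourierBasis_repr, HilbertBasis.repr_apply_apply, coe_fourierBasis]

lemma mem_K_iff (θ : InnerFunction) (f : L2) :
    f ∈ K θ ↔ f ∈ H2 ∧ ∀ h ∈ H2, ⟪(bd θ • h : L2), f⟫_ℂ = 0 := by
  simp only [K, Submodule.mem_inf, Submodule.mem_orthogonal, Submodule.mem_map,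
    forall_exists_index, and_imp, forall_apply_eq_imp_iff₂]
  rfl

lemma inner_eq_zero_of_coeff {f g : L2} (hf : ∀ n : ℤ, 0 ≤ n → ⟪fourierLp 2 n, f⟫_ℂ = 0)
    (hg : g ∈ H2) : ⟪f, g⟫_ℂ = 0 := by
  rw [mem_H2_iff] at hg
  rw [← (fourierBasis (T := 2 * π)).tsum_inner_mul_inner f g]
  have : ∀ n : ℤ, ⟪f, fourierBasis (T := 2 * π) n⟫_ℂ * ⟪fourierBasis (T := 2 * π) n, g⟫_ℂ = 0 := by
    intro n
    rw [coe_fourierBasis]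
    rcases lt_or_ge n 0 with hn | hn
    · rw [hg n hn, mul_zero]
    · rw [← inner_conj_symm, hf n hn, map_zero, zero_mul]
  rw [tsum_congr this, tsum_zero]

lemma coe_bd (θ : InnerFunction) : ⇑(bd θ) =ᵐ[m] bdFun θ := MemLp.coeFn_toLp _

lemma norm_bd (θ : InnerFunction) : ∀ᵐ t ∂m, ‖bd θ t‖ = 1 := by
  filter_upwards [coe_bd θ, norm_bdFun θ] with t h1 h2
  rw [h1, h2]

lemma conj_mul_bd (θ : InnerFunction) : ∀ᵐ t ∂m, conj (bd θ t) * bd θ t = 1 := by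
  filter_upwards [norm_bd θ] with t h
  rw [Complex.conj_mul', h]
  simp

lemma coe_smul (u : Linf) (f : L2) : ⇑(u • f : L2) =ᵐ[m] fun t => u t * f t := by
  filter_upwards [Lp.coeFn_lpSMul (r := 2) u f] with t h
  rw [h]
  rfl

lemma coe_star (f : L2) : ⇑(star f : L2) =ᵐ[m] fun t => conj (f t) := by
  filter_upwards [Lp.coeFn_star f] with t h
  rw [h]
  rfl

lemma coe_star_inf (f : Linf) : ⇑(star f : Linf) =ᵐ[m] fun t => conj (f t) := by
  filter_upwards [Lp.coeFn_star f] with t h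
  rw [h]
  rfl

lemma coe_zbar : ⇑zbar =ᵐ[m] fun t => fourier (-1) t := coeFn_fourierLp _ _

lemma inner_def' (f g : L2) : ⟪f, g⟫_ℂ = ∫ t, g t * conj (f t) ∂m := by
  rw [L2.inner_def]
  rfl

lemma bd_smul_bd (θ α β : InnerFunction) (h : IsQuotient θ α β) (f : L2) :
    (bd θ • f : L2) = (bd α • (bd β • f : L2) : L2) := by
  have key : ∀ᵐ t ∂m, bdFun θ t = bdFun α t * bdFun β t := by
    filter_upwards [bdFun_tendsto θ, bdFun_tendsto α, bdFun_tendsto β] with t h1 h2 h3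
    refine tendsto_nhds_unique (h1.comp rad_tendsto)
      (((h2.comp rad_tendsto).mul (h3.comp rad_tendsto)).congr fun n => ?_)
    exact (h _ (rad_mem n t)).symm
  refine Lp.ext ?_
  filter_upwards [key, coe_smul (bd θ) f, coe_smul (bd α) (bd β • f : L2), coe_smul (bd β) f,
    coe_bd θ, coe_bd α, coe_bd β] with t h0 h1 h2 h3 h4 h5 h6
  rw [h1, h2, h3, h4, h5, h6, h0, mul_assoc]

lemma inner_bd_smul_bd_smul (θ : InnerFunction) (f g : L2) :
    ⟪(bd θ • f : L2), (bd θ • g : L2)⟫_ℂ = ⟪f, g⟫_ℂ := by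
  rw [inner_def', inner_def']
  refine integral_congr_ae ?_
  filter_upwards [coe_smul (bd θ) f, coe_smul (bd θ) g, conj_mul_bd θ] with t h1 h2 h3
  rw [h1, h2, map_mul]
  linear_combination (g t * conj (f t)) * h3

/-- The mean of `θ(r z) z^k` vanishes for `k ≥ 1`. -/
lemma integral_rad (θ : InnerFunction) (n k : ℕ) :
    ∫ t, θ.toFun (rad n * (AddCircle.toCircle t : ℂ)) * fourier ((k : ℤ) + 1) t ∂m = 0 := by
  have hc : ∮ w in C(0, rad n), θ.toFun w * w ^ k = 0 := by
    have hsub : Metric.closedBall (0 : ℂ) (rad n) ⊆ Metric.ball 0 1 :=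
      Metric.closedBall_subset_ball (rad_lt n)
    refine Complex.circleIntegral_eq_zero_of_differentiable_on_off_countable (rad_pos n).le
      Set.countable_empty ?_ ?_
    · exact (θ.differentiableOn.continuousOn.mono hsub).mul (by fun_prop)
    · intro w hw
      have hw' : w ∈ Metric.ball (0 : ℂ) 1 := hsub (Metric.ball_subset_closedBall hw.1)
      exact (θ.differentiableOn.differentiableAt (Metric.isOpen_ball.mem_nhds hw')).mul
        (by fun_prop)
  rw [AddCircle.integral_haarAddCircle, ← AddCircle.intervalIntegral_preimage (2 * π) 0]
  rw [circleIntegral] at hc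
  have e : ∀ x : ℝ, deriv (circleMap 0 (rad n)) x •
      (θ.toFun (circleMap 0 (rad n) x) * circleMap 0 (rad n) x ^ k) =
      ((rad n : ℂ) ^ (k + 1) * Complex.I) *
      (θ.toFun (rad n * (AddCircle.toCircle (x : Torus) : ℂ)) *
        fourier ((k : ℤ) + 1) (x : Torus)) := by
    intro x
    have hx : (AddCircle.toCircle (x : Torus) : ℂ) = Complex.exp (x * Complex.I) := by
      rw [AddCircle.toCircle_apply_mk, Circle.coe_exp]
      congr 3
      field_simp
    have h2 : fourier (T := 2 * π) ((k : ℤ) + 1) (x : Torus) = Complex.exp (x * Complex.I) ^ (k + 1) := by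
      rw [fourier_apply, AddCircle.toCircle_zsmul, ← hx]
      norm_cast
    rw [deriv_circleMap, h2, hx]
    simp only [circleMap, zero_add, smul_eq_mul]
    ring
  simp only [e] at hc
  rw [intervalIntegral.integral_const_mul] at hc
  have hne : (rad n : ℂ) ^ (k + 1) * Complex.I ≠ 0 :=
    mul_ne_zero (pow_ne_zero _ (by exact_mod_cast (rad_pos n).ne')) Complex.I_ne_zero
  have := (mul_eq_zero.1 hc).resolve_left hne
  simp only [zero_add] at this ⊢
  rw [this, smul_zero]

/-- The Fourier coefficients of negative index of the boundary function of an inner function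
vanish. -/
lemma integral_bdFun (θ : InnerFunction) (k : ℕ) :
    ∫ t, bdFun θ t * fourier ((k : ℤ) + 1) t ∂m = 0 := by
  obtain ⟨M, hM⟩ := θ.bounded
  have ht := tendsto_integral_of_dominated_convergence (μ := m) (fun _ => M)
    (F := fun n t => θ.toFun (rad n * (AddCircle.toCircle t : ℂ)) * fourier ((k : ℤ) + 1) t)
    (f := fun t => bdFun θ t * fourier ((k : ℤ) + 1) t)
    (fun n => ((continuous_rad θ n).mul (map_continuous _)).aestronglyMeasurable)
    (integrable_const _)
    (fun n => Eventually.of_forall fun t => by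
      rw [norm_mul, fourier_apply, Circle.norm_coe, mul_one]
      exact hM _ (rad_mem n t))
    (by
      filter_upwards [bdFun_tendsto θ] with t h
      exact (h.comp rad_tendsto).mul_const _)
  simp only [integral_rad] at ht
  exact (tendsto_nhds_unique ht tendsto_const_nhds)

lemma coe_fourier (n : ℤ) : ⇑(fourierLp (T := 2 * π) 2 n) =ᵐ[m] fun t => fourier n t :=
  coeFn_fourierLp 2 n

lemma bd_smul_mem_H2 (θ : InnerFunction) {f : L2} (hf : f ∈ H2) : (bd θ • f : L2) ∈ H2 := by
  rw [mem_H2_iff]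
  intro n hn
  have e : ⟪(fourierLp (T := 2 * π) 2 n : L2), (bd θ • f : L2)⟫_ℂ =
      ⟪(star (bd θ) • (fourierLp (T := 2 * π) 2 n : L2) : L2), f⟫_ℂ := by
    rw [inner_def', inner_def']
    refine integral_congr_ae ?_
    filter_upwards [coe_smul (bd θ) f, coe_smul (star (bd θ)) (fourierLp 2 n),
      coe_star_inf (bd θ)] with t h1 h2 h3
    rw [h1, h2, h3, map_mul, Complex.conj_conj]
    ring
  rw [e]
  refine inner_eq_zero_of_coeff (fun k hk => ?_) hf
  rw [inner_def']
  obtain ⟨j, hj⟩ := Int.eq_ofNat_of_zero_le (show 0 ≤ k - n - 1 by lia)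
  have h0 := congrArg conj (integral_bdFun θ j)
  rw [map_zero, ← integral_conj] at h0
  rw [← h0]
  refine integral_congr_ae ?_
  filter_upwards [coe_smul (star (bd θ)) (fourierLp 2 n), coe_star_inf (bd θ), coe_bd θ,
    coe_fourier n, coe_fourier k] with t h1 h2 h3 h4 h5
  rw [h1, h2, h3, h4, h5, map_mul, mul_assoc, ← fourier_neg, ← fourier_neg, ← fourier_add]
  congr 3
  lia

/-- `f ↦ θ z̄ f̄` on `L²`. -/
def conjL2 (θ : InnerFunction) : L2 →ₗ⋆[ℂ] L2 where
  toFun f := bd θ • (zbar • star f : L2)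
  map_add' f g := by
    refine Lp.ext ?_
    filter_upwards [coe_smul (bd θ) (zbar • star (f + g) : L2), coe_smul zbar (star (f + g)),
      coe_star (f + g), Lp.coeFn_add f g,
      Lp.coeFn_add (bd θ • (zbar • star f : L2) : L2) (bd θ • (zbar • star g : L2) : L2),
      coe_smul (bd θ) (zbar • star f : L2), coe_smul zbar (star f), coe_star f,
      coe_smul (bd θ) (zbar • star g : L2), coe_smul zbar (star g), coe_star g]
      with t h1 h2 h3 h4 h5 h6 h7 h8 h9 h10 h11
    rw [h1, h2, h3, h4, h5, Pi.add_apply, Pi.add_apply, h6, h7, h8, h9, h10, h11, map_add]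
    ring
  map_smul' c f := by
    refine Lp.ext ?_
    filter_upwards [coe_smul (bd θ) (zbar • star (c • f) : L2), coe_smul zbar (star (c • f)),
      coe_star (c • f), Lp.coeFn_smul c f,
      Lp.coeFn_smul (conj c) (bd θ • (zbar • star f : L2) : L2),
      coe_smul (bd θ) (zbar • star f : L2), coe_smul zbar (star f), coe_star f]
      with t h1 h2 h3 h4 h5 h6 h7 h8
    rw [h1, h2, h3, h4, h5, Pi.smul_apply, Pi.smul_apply, h6, h7, h8, smul_eq_mul, smul_eq_mul,
      map_mul]
    ring

lemma conjL2_ae (θ : InnerFunction) (f : L2) :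
    ⇑(conjL2 θ f) =ᵐ[m] fun t => bd θ t * (fourier (-1) t * conj (f t)) := by
  filter_upwards [coe_smul (bd θ) (zbar • star f : L2), coe_smul zbar (star f), coe_star f,
    coe_zbar] with t h1 h2 h3 h4
  change (bd θ • (zbar • star f : L2) : L2) t = _
  rw [h1, h2, h3, h4]

lemma conjL2_mem (θ : InnerFunction) {f : L2} (hf : f ∈ K θ) : conjL2 θ f ∈ K θ := by
  rw [mem_K_iff] at hf ⊢
  obtain ⟨hf, hθ⟩ := hf
  constructor
  · rw [mem_H2_iff]
    intro n hn
    have hmem : (fourierLp 2 (-1 - n) : L2) ∈ H2 := by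
      rw [mem_H2_iff]
      intro k hk
      have := orthonormal_fourier (T := 2 * π)
      exact this.2 (by lia)
    have h0 := congrArg conj (hθ _ hmem)
    rw [map_zero, inner_def', ← integral_conj] at h0
    rw [← h0, inner_def']
    refine integral_congr_ae ?_
    filter_upwards [conjL2_ae θ f, coe_fourier n, coe_fourier (-1 - n),
      coe_smul (bd θ) (fourierLp 2 (-1 - n))] with t h1 h2 h3 h4
    rw [h1, h2, h4, h3, map_mul, Complex.conj_conj, ← fourier_neg, sub_eq_add_neg, fourier_add]
    ring
  · intro h hh
    change ⟪(bd θ • h : L2), (bd θ • (zbar • star f : L2) : L2)⟫_ℂ = 0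
    rw [inner_bd_smul_bd_smul, ← inner_conj_symm, inner_eq_zero_of_coeff _ hh, map_zero]
    intro n hn
    have h0 := congrArg conj ((mem_H2_iff f).1 hf (-1 - n) (by lia))
    rw [map_zero, inner_def', ← integral_conj] at h0
    rw [← h0, inner_def']
    refine integral_congr_ae ?_
    filter_upwards [coe_smul zbar (star f), coe_star f, coe_zbar, coe_fourier n,
      coe_fourier (-1 - n)] with t h1 h2 h3 h4 h5
    rw [h1, h2, h3, h4, h5, map_mul, Complex.conj_conj, ← fourier_neg, sub_eq_add_neg, fourier_add]
    ring

lemma K_le_K {θ α β : InnerFunction} (h : IsQuotient θ α β) : K α ≤ K θ := by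
  intro f hf
  rw [mem_K_iff] at hf ⊢
  refine ⟨hf.1, fun g hg => ?_⟩
  rw [bd_smul_bd θ α β h]
  exact hf.2 _ (bd_smul_mem_H2 β hg)

lemma bd_smul_mem_K {θ α β : InnerFunction} (h : IsQuotient θ α β) {f : L2} (hf : f ∈ K β) :
    (bd α • f : L2) ∈ K θ := by
  rw [mem_K_iff] at hf ⊢
  refine ⟨bd_smul_mem_H2 α hf.1, fun g hg => ?_⟩
  rw [bd_smul_bd θ α β h, inner_bd_smul_bd_smul]
  exact hf.2 _ hg

/-! ### The two conjugations -/

/-- The conjugation `C_θ f = θ z̄ f̄` on the model space `K_θ`. -/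
def C (θ : InnerFunction) : K θ →ₗ⋆[ℂ] K θ where
  toFun f := ⟨conjL2 θ f, conjL2_mem θ f.2⟩
  map_add' f g := Subtype.ext (map_add (conjL2 θ) (f : L2) g)
  map_smul' c f := Subtype.ext ((conjL2 θ).map_smulₛₗ c (f : L2))

/-- The conjugation `C_{α,β} = C_α ⊕ α C_β ᾱ` on `K_θ = K_α ⊕ α K_β`, where `β = θ / α`. The
components in `K_α` and in `K_β` of `f = g₁ + α g₂` are `g₁ = P_α f` and `g₂ = P_β (ᾱ f)`
(see `conjPair_apply`). -/
def conjPair {θ α β : InnerFunction} (h : IsQuotient θ α β) (f : K θ) : K θ :=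
  ⟨(C α (P α f) : L2) + (bd α • (C β (P β (star (bd α) • (f : L2) : L2)) : L2) : L2),
    (K θ).add_mem (K_le_K h (C α _).2) (bd_smul_mem_K h (C β _).2)⟩

/-- `C_{α,β} (g₁ + α g₂) = C_α g₁ + α C_β g₂` for `g₁ ∈ K_α`, `g₂ ∈ K_β`. -/
lemma conjPair_apply {θ α β : InnerFunction} (h : IsQuotient θ α β) (f : K θ) (g₁ : K α) (g₂ : K β)
    (hf : (f : L2) = g₁ + (bd α • (g₂ : L2) : L2)) :
    (conjPair h f : L2) = C α g₁ + (bd α • (C β g₂ : L2) : L2) := by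
  have h1 : P α f = g₁ := by
    rw [hf, map_add]
    have e1 : P α (g₁ : L2) = g₁ := Submodule.orthogonalProjectionOnto_mem_subspace_eq_self g₁
    have e2 : P α (bd α • (g₂ : L2) : L2) = 0 := by
      refine Submodule.orthogonalProjectionOnto_apply_of_mem_orthogonal ?_
      rw [Submodule.mem_orthogonal']
      intro u hu
      exact ((mem_K_iff α u).1 hu).2 _ ((mem_K_iff β _).1 g₂.2).1
    rw [e1, e2, add_zero]
  have h2 : P β (star (bd α) • (f : L2) : L2) = g₂ := by
    have e0 : (star (bd α) • (f : L2) : L2) = (star (bd α) • (g₁ : L2) : L2) + g₂ := by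
      refine Lp.ext ?_
      rw [hf]
      filter_upwards [coe_smul (star (bd α)) ((g₁ : L2) + (bd α • (g₂ : L2) : L2)),
        coe_star_inf (bd α), Lp.coeFn_add (g₁ : L2) (bd α • (g₂ : L2) : L2),
        coe_smul (bd α) (g₂ : L2), Lp.coeFn_add (star (bd α) • (g₁ : L2) : L2) (g₂ : L2),
        coe_smul (star (bd α)) (g₁ : L2), conj_mul_bd α] with t h1 h2 h3 h4 h5 h6 h7
      rw [h1, h2, h3, h5, Pi.add_apply, Pi.add_apply, h4, h6, h2]
      linear_combination (g₂ : L2) t * h7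
    rw [e0, map_add]
    have e1 : P β (g₂ : L2) = g₂ := Submodule.orthogonalProjectionOnto_mem_subspace_eq_self g₂
    have e2 : P β (star (bd α) • (g₁ : L2) : L2) = 0 := by
      refine Submodule.orthogonalProjectionOnto_apply_of_mem_orthogonal ?_
      rw [Submodule.mem_orthogonal]
      intro u hu
      rw [← ((mem_K_iff α g₁).1 g₁.2).2 u ((mem_K_iff β u).1 hu).1, inner_def', inner_def']
      refine integral_congr_ae ?_
      filter_upwards [coe_smul (star (bd α)) (g₁ : L2), coe_smul (bd α) u, coe_star_inf (bd α)]
        with t h1 h2 h3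
      rw [h1, h2, h3, map_mul]
      ring
    rw [e1, e2, zero_add]
  simp only [conjPair, h1, h2]

end ATTO

end

open ATTO

/-! Write β = θ/α. Let D be either conjugation of K_θ. On K_α it acts as f ↦ γ z̄ f̄, with γ = θ or
γ = α. If φ is a symbol of A, then ⟪f, A D g⟫ is formally ∫ φ γ z̄ f̄ ḡ, which is symmetric in f, g
∈ K_α (`inner_apply_conjL2_comm`). So A D = D A* P_α always holds when compressed to K_α. Since P_α
kills α K_β, the identity on all of K_θ is equivalent to A D vanishing on α K_β
(`apply_conj_eq_iff`). Now C_θ maps α K_β onto K_β, while C_{α,β} maps α K_β onto itself. The two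
claims thus become: A vanishes on K_β iff it has a symbol in the conjugate of β K_α, and A vanishes
on α K_β iff it has a symbol in K_α.

For these, pair A with C_α k, k ∈ K_α. Vanishing says that ᾱφ, respectively φ, annihilates every
product z k g with k ∈ K_α, g ∈ K_β. The core is `exists_eq_star_add_of_forall`: such a function
lies in conj(θH²) + H². It rests on two explicit bounded elements of each model space, the kernel 1
− conj(θ(0)) θ and the backward shift z̄(θ − θ(0)). Together they give a 2×2 linear system of
determinant 1 − |θ(0)|², nonzero for a nonconstant inner function. Symbols in conj(θH²) + αH² induce
the zero operator, so reducing modulo αH² leaves a component in K_α.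

Products of L² functions need not be in L², so pairings are computed on bounded elements of the
model spaces and extended by density (`dense_boundedK`, `isATTO_iff`). -/

noncomputable section

namespace ATTO

/-! ### Monomials and the action of bounded functions on L² -/

/-- The character `z ^ n` as an element of `L²`. -/
def monomial (n : ℤ) : L2 := fourierLp 2 n

/-- The character `z ^ n` as an element of `L^∞`. -/
def monomialInf (n : ℤ) : Linf := fourierLp ∞ n

/-- The inclusion of `L^∞` in `L²`. -/
def toL2 (u : Linf) : L2 := u • monomial 0

lemma coe_monomialInf (n : ℤ) : ⇑(monomialInf n) =ᵐ[m] fun t => fourier n t :=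
  coeFn_fourierLp _ _

lemma coe_toL2 (u : Linf) : ⇑(toL2 u) =ᵐ[m] u := by
  filter_upwards [coe_smul u (monomial 0), coe_fourier 0] with t h1 h2
  rw [toL2, h1, monomial, h2, fourier_zero, mul_one]

lemma smul_smul_comm (u v : Linf) (f : L2) :
    (u • (v • f : L2) : L2) = (v • (u • f : L2) : L2) := by
  refine Lp.ext ?_
  filter_upwards [coe_smul u (v • f : L2), coe_smul v (u • f : L2), coe_smul u f, coe_smul v f]
    with t h1 h2 h3 h4
  rw [h1, h2, h3, h4]
  ring

lemma inner_smul_eq (u : Linf) (f g : L2) :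
    ⟪f, (u • g : L2)⟫_ℂ = ⟪(star u • f : L2), g⟫_ℂ := by
  rw [inner_def', inner_def']
  refine integral_congr_ae ?_
  filter_upwards [coe_smul u g, coe_smul (star u) f, coe_star_inf u] with t h1 h2 h3
  rw [h1, h2, h3, map_mul, Complex.conj_conj]
  ring

lemma inner_smul_eq' (u : Linf) (f g : L2) :
    ⟪(u • f : L2), g⟫_ℂ = ⟪f, (star u • g : L2)⟫_ℂ := by
  rw [inner_smul_eq, star_star]

lemma star_smul_eq (u : Linf) (f : L2) : star (u • f : L2) = (star u • star f : L2) := by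
  refine Lp.ext ?_
  filter_upwards [coe_star (u • f : L2), coe_smul u f, coe_smul (star u) (star f),
    coe_star_inf u, coe_star f] with t h1 h2 h3 h4 h5
  rw [h1, h2, h3, h4, h5, map_mul]

lemma inner_star_star (f g : L2) : ⟪star f, star g⟫_ℂ = ⟪g, f⟫_ℂ := by
  rw [inner_def', inner_def']
  refine integral_congr_ae ?_
  filter_upwards [coe_star f, coe_star g] with t h1 h2
  rw [h1, h2, Complex.conj_conj, mul_comm]

/-- Both sides are ∫ u f g. This is the source of the symmetry of the conjugations. -/
lemma inner_star_smul_comm (f g : L2) (u : Linf) :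
    ⟪star f, (u • g : L2)⟫_ℂ = ⟪star g, (u • f : L2)⟫_ℂ := by
  rw [inner_smul_eq, ← inner_star_star, star_smul_eq, star_star, star_star]

lemma star_smul_const (c : ℂ) (f : L2) : star (c • f) = conj c • star f := by
  refine Lp.ext ?_
  filter_upwards [coe_star (c • f), Lp.coeFn_smul c f, coe_star f, Lp.coeFn_smul (conj c) (star f)]
    with t h1 h2 h3 h4
  rw [h1, h2, h4, Pi.smul_apply, Pi.smul_apply, h3, smul_eq_mul, smul_eq_mul, map_mul]

lemma star_sub' (f g : L2) : star (f - g) = star f - star g := by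
  refine Lp.ext ?_
  filter_upwards [coe_star (f - g), Lp.coeFn_sub f g, coe_star f, coe_star g,
    Lp.coeFn_sub (star f) (star g)] with t h1 h2 h3 h4 h5
  rw [h1, h2, h5, Pi.sub_apply, Pi.sub_apply, h3, h4, map_sub]

lemma star_add' (f g : L2) : star (f + g) = star f + star g := by
  refine Lp.ext ?_
  filter_upwards [coe_star (f + g), Lp.coeFn_add f g, coe_star f, coe_star g,
    Lp.coeFn_add (star f) (star g)] with t h1 h2 h3 h4 h5
  rw [h1, h2, h5, Pi.add_apply, Pi.add_apply, h3, h4, map_add]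

lemma star_monomialInf (n : ℤ) : star (monomialInf n) = monomialInf (-n) := by
  refine Lp.ext ?_
  filter_upwards [coe_star_inf (monomialInf n), coe_monomialInf n, coe_monomialInf (-n)]
    with t h1 h2 h3
  rw [h1, h2, h3, fourier_neg]

lemma star_monomial (n : ℤ) : star (monomial n) = monomial (-n) := by
  refine Lp.ext ?_
  filter_upwards [coe_star (monomial n), coe_fourier n, coe_fourier (-n)] with t h1 h2 h3
  rw [h1, monomial, monomial, h2, h3, fourier_neg]

lemma monomialInf_smul_smul (k n : ℤ) (f : L2) :
    (monomialInf k • (monomialInf n • f : L2) : L2) = (monomialInf (k + n) • f : L2) := by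
  refine Lp.ext ?_
  filter_upwards [coe_smul (monomialInf k) (monomialInf n • f : L2), coe_smul (monomialInf n) f,
    coe_smul (monomialInf (k + n)) f, coe_monomialInf k, coe_monomialInf n,
    coe_monomialInf (k + n)] with t h1 h2 h3 h4 h5 h6
  rw [h1, h2, h3, h4, h5, h6, fourier_add, mul_assoc]

lemma monomialInf_zero_smul (f : L2) : (monomialInf 0 • f : L2) = f := by
  refine Lp.ext ?_
  filter_upwards [coe_smul (monomialInf 0) f, coe_monomialInf 0] with t h1 h2
  rw [h1, h2, fourier_zero, one_mul]

lemma monomialInf_smul_monomial (k n : ℤ) :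
    (monomialInf k • monomial n : L2) = monomial (k + n) := by
  refine Lp.ext ?_
  filter_upwards [coe_smul (monomialInf k) (monomial n), coe_monomialInf k, coe_fourier n,
    coe_fourier (k + n)] with t h1 h2 h3 h4
  rw [h1, h2, monomial, monomial, h3, h4, fourier_add]

lemma toL2_monomialInf (n : ℤ) : toL2 (monomialInf n) = monomial n := by
  rw [toL2, monomialInf_smul_monomial, add_zero]

lemma smul_sub' (u : Linf) (f g : L2) : (u • (f - g) : L2) = (u • f : L2) - (u • g : L2) :=
  map_sub (mulBy u) f g

lemma smul_const' (u : Linf) (c : ℂ) (f : L2) : (u • (c • f) : L2) = c • (u • f : L2) :=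
  map_smul (mulBy u) c f

lemma sub_smul' (u v : Linf) (f : L2) : ((u - v) • f : L2) = (u • f : L2) - (v • f : L2) := by
  rw [sub_eq_add_neg, Lp.smul_add, Lp.neg_smul, sub_eq_add_neg]

lemma const_smul' (c : ℂ) (u : Linf) (f : L2) : ((c • u) • f : L2) = c • (u • f : L2) := by
  refine Lp.ext ?_
  filter_upwards [coe_smul (c • u) f, Lp.coeFn_smul c u, Lp.coeFn_smul c (u • f : L2),
    coe_smul u f] with t h1 h2 h3 h4
  rw [h1, h2, h3, Pi.smul_apply, Pi.smul_apply, h4, smul_eq_mul, smul_eq_mul, mul_assoc]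

lemma smul_smul' (u v : Linf) (f : L2) :
    ((u • v : Linf) • f : L2) = (u • (v • f : L2) : L2) := by
  refine Lp.ext ?_
  filter_upwards [coe_smul (u • v : Linf) f, Lp.coeFn_lpSMul (r := ∞) u v,
    coe_smul u (v • f : L2), coe_smul v f] with t h1 h2 h3 h4
  rw [h1, h2, h3, h4, Pi.smul_apply', smul_eq_mul, mul_assoc]

lemma toL2_smul (u v : Linf) : toL2 (u • v : Linf) = (u • toL2 v : L2) := smul_smul' _ _ _

lemma toL2_const (c : ℂ) (u : Linf) : toL2 (c • u) = c • toL2 u := const_smul' _ _ _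

lemma toL2_add (u v : Linf) : toL2 (u + v) = toL2 u + toL2 v := Lp.smul_add _ _ _

lemma toL2_star (u : Linf) : toL2 (star u) = star (toL2 u) := by
  rw [toL2, toL2, star_smul_eq, star_monomial, neg_zero]

lemma smul_toL2_comm (u v : Linf) : (u • toL2 v : L2) = (v • toL2 u : L2) :=
  smul_smul_comm _ _ _

lemma star_bd_smul_bd_smul (θ : InnerFunction) (f : L2) :
    (star (bd θ) • (bd θ • f : L2) : L2) = f := by
  refine Lp.ext ?_
  filter_upwards [coe_smul (star (bd θ)) (bd θ • f : L2), coe_smul (bd θ) f, coe_star_inf (bd θ),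
    conj_mul_bd θ] with t h1 h2 h3 h4
  rw [h1, h2, h3, ← mul_assoc, h4, one_mul]

lemma bd_smul_star_bd_smul (θ : InnerFunction) (f : L2) :
    (bd θ • (star (bd θ) • f : L2) : L2) = f := by
  rw [smul_smul_comm, star_bd_smul_bd_smul]

lemma continuous_smul' (u : Linf) : Continuous fun f : L2 => (u • f : L2) :=
  AddMonoidHomClass.continuous_of_bound (mulBy u) ‖u‖ fun f => Lp.norm_smul_le u f

/-! ### The Hardy space and its complement -/

instance : CompleteSpace H2 := isClosed_H2.completeSpace_coe

lemma monomial_mem_H2 {n : ℤ} (hn : 0 ≤ n) : monomial n ∈ H2 := by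
  rw [mem_H2_iff]
  intro k hk
  exact (orthonormal_fourier (T := 2 * π)).2 (by lia)

lemma mem_H2_orthogonal_iff (f : L2) : f ∈ H2ᗮ ↔ ∀ n : ℤ, 0 ≤ n → ⟪monomial n, f⟫_ℂ = 0 := by
  refine ⟨fun hf n hn => Submodule.inner_right_of_mem_orthogonal (monomial_mem_H2 hn) hf,
    fun hf => ?_⟩
  rw [Submodule.mem_orthogonal']
  exact fun u hu => inner_eq_zero_of_coeff hf hu

lemma monomial_mem_H2_orthogonal {n : ℤ} (hn : n < 0) : monomial n ∈ H2ᗮ := by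
  rw [mem_H2_orthogonal_iff]
  intro k hk
  exact (orthonormal_fourier (T := 2 * π)).2 (by lia)

lemma mem_H2_iff' (f : L2) : f ∈ H2 ↔ ∀ n : ℤ, n < 0 → ⟪monomial n, f⟫_ℂ = 0 := mem_H2_iff f

lemma inner_monomial_smul (n k : ℤ) (f : L2) :
    ⟪monomial n, (monomialInf k • f : L2)⟫_ℂ = ⟪monomial (n - k), f⟫_ℂ := by
  rw [inner_smul_eq, star_monomialInf, monomialInf_smul_monomial, neg_add_eq_sub]

lemma inner_monomial_star (n : ℤ) (f : L2) :
    ⟪monomial n, star f⟫_ℂ = conj ⟪monomial (-n), f⟫_ℂ := by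
  rw [← inner_star_star, star_star, star_monomial, inner_conj_symm]

lemma monomialInf_smul_mem_H2 {k : ℤ} (hk : 0 ≤ k) {f : L2} (hf : f ∈ H2) :
    (monomialInf k • f : L2) ∈ H2 := by
  rw [mem_H2_iff'] at hf ⊢
  intro n hn
  rw [inner_monomial_smul]
  exact hf _ (by lia)

lemma monomialInf_smul_mem_H2_orthogonal {k : ℤ} (hk : k ≤ 0) {f : L2} (hf : f ∈ H2ᗮ) :
    (monomialInf k • f : L2) ∈ H2ᗮ := by
  rw [mem_H2_orthogonal_iff] at hf ⊢
  intro n hn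
  rw [inner_monomial_smul]
  exact hf _ (by lia)

lemma star_mem_H2_of_orthogonal {f : L2} (hf : f ∈ H2ᗮ) : star f ∈ H2 := by
  rw [mem_H2_orthogonal_iff] at hf
  rw [mem_H2_iff']
  intro n hn
  rw [inner_monomial_star, hf _ (by lia), map_zero]

/-- Frequencies in `H2ᗮ` are at most −1, so one factor z still leaves none that is positive. -/
lemma star_shift_mem_H2_of_orthogonal {f : L2} (hf : f ∈ H2ᗮ) :
    star (monomialInf 1 • f : L2) ∈ H2 := by
  rw [mem_H2_orthogonal_iff] at hf
  rw [mem_H2_iff']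
  intro n hn
  rw [inner_monomial_star, inner_monomial_smul, hf _ (by lia), map_zero]

lemma star_shift_mem_H2_orthogonal {f : L2} (hf : f ∈ H2) :
    star (monomialInf 1 • f : L2) ∈ H2ᗮ := by
  rw [mem_H2_iff'] at hf
  rw [mem_H2_orthogonal_iff]
  intro n hn
  rw [inner_monomial_star, inner_monomial_smul, hf _ (by lia), map_zero]

/-- `H²` is a module over the bounded functions in `H²`. -/
lemma smul_mem_H2 {u : Linf} (hu : toL2 u ∈ H2) {f : L2} (hf : f ∈ H2) : (u • f : L2) ∈ H2 := by
  rw [mem_H2_iff'] at hu ⊢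
  intro n hn
  rw [inner_smul_eq]
  refine inner_eq_zero_of_coeff (fun k hk => ?_) hf
  change ⟪monomial k, _⟫_ℂ = 0
  have e : (star u • monomial n : L2) = star (monomialInf (-n) • toL2 u : L2) := by
    rw [star_smul_eq, ← toL2_star, smul_toL2_comm, star_monomialInf, neg_neg, toL2_monomialInf]
  rw [e, inner_monomial_star, inner_monomial_smul, hu _ (by lia), map_zero]

lemma K_le_H2 (θ : InnerFunction) : K θ ≤ H2 := inf_le_left

/-- A function in `H²` orthogonal to the model space `K_α` is divisible by `α`. -/
lemma exists_eq_bd_smul (α : InnerFunction) {x : L2} (hx : x ∈ H2)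
    (h : ∀ k ∈ K α, ⟪k, x⟫_ℂ = 0) : ∃ y ∈ H2, x = (bd α • y : L2) := by
  set y : L2 := H2.starProjection (star (bd α) • x : L2)
  have hy : y ∈ H2 := Submodule.starProjection_apply_mem _ _
  have hr : x - (bd α • y : L2) ∈ K α := by
    rw [mem_K_iff]
    refine ⟨H2.sub_mem hx (bd_smul_mem_H2 α hy), fun g hg => ?_⟩
    rw [inner_smul_eq', smul_sub', star_bd_smul_bd_smul]
    exact Submodule.inner_right_of_mem_orthogonal hg (Submodule.sub_starProjection_mem_orthogonal _)
  refine ⟨y, hy, ?_⟩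
  rw [← sub_eq_zero, ← inner_self_eq_zero (𝕜 := ℂ)]
  refine (inner_sub_right _ _ _).trans ?_
  rw [h _ hr, ← inner_conj_symm, ((mem_K_iff α _).1 hr).2 y hy, map_zero, sub_zero]

/-- A function orthogonal to the model space `K_α` is in `α H² ⊕ (H²)ᗮ`. -/
lemma exists_eq_bd_smul_add (α : InnerFunction) {x : L2} (h : ∀ k ∈ K α, ⟪k, x⟫_ℂ = 0) :
    ∃ y ∈ H2, ∃ r ∈ H2ᗮ, x = (bd α • y : L2) + r := by
  have hr := H2.sub_starProjection_mem_orthogonal x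
  obtain ⟨y, hy, e⟩ := exists_eq_bd_smul α (x := H2.starProjection x)
    (Submodule.starProjection_apply_mem _ _) fun k hk => by
      rw [← sub_sub_cancel x (H2.starProjection x), inner_sub_right, h k hk,
        Submodule.inner_right_of_mem_orthogonal (K_le_H2 α hk) hr, sub_zero]
  exact ⟨y, hy, _, hr, by rw [← e, add_sub_cancel]⟩

/-! ### Bounded functions in the model spaces -/

/-- The backward shift on `L^∞`. -/
def backwardShift (u : Linf) : Linf :=
  monomialInf (-1) • (u - ⟪monomial 0, toL2 u⟫_ℂ • monomialInf 0 : Linf)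

lemma backwardShift_smul (u : Linf) (f : L2) : (backwardShift u • f : L2) =
    (monomialInf (-1) • ((u • f : L2) - ⟪monomial 0, toL2 u⟫_ℂ • f) : L2) := by
  rw [backwardShift, smul_smul', sub_smul', const_smul', monomialInf_zero_smul]

lemma toL2_backwardShift (u : Linf) : toL2 (backwardShift u) =
    (monomialInf (-1) • (toL2 u - ⟪monomial 0, toL2 u⟫_ℂ • monomial 0) : L2) :=
  backwardShift_smul u _

lemma inner_monomial_self (n : ℤ) : ⟪monomial n, monomial n⟫_ℂ = 1 := by
  rw [inner_self_eq_norm_sq_to_K, monomial, (orthonormal_fourier (T := 2 * π)).1 n]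
  simp

lemma inner_monomial_of_ne {n k : ℤ} (h : n ≠ k) : ⟪monomial n, monomial k⟫_ℂ = 0 :=
  (orthonormal_fourier (T := 2 * π)).2 h

lemma toL2_backwardShift_mem_H2 {u : Linf} (hu : toL2 u ∈ H2) :
    toL2 (backwardShift u) ∈ H2 := by
  rw [mem_H2_iff'] at hu ⊢
  intro n hn
  rw [toL2_backwardShift, inner_monomial_smul, inner_sub_right, inner_smul_right]
  rcases eq_or_ne n (-1) with rfl | h
  -- The mean of `u` would land at frequency −1; it is exactly what was subtracted.
  · rw [sub_neg_eq_add, neg_add_cancel, inner_monomial_self, mul_one, sub_self]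
  · rw [hu _ (by lia), inner_monomial_of_ne (by lia), mul_zero, sub_zero]

/-- Orthogonality to zθH² suffices, which covers both u ∈ K_θ and u = θ itself; the subtracted
constant only contributes a multiple of z̄, orthogonal to H². -/
lemma toL2_backwardShift_mem_K (θ : InnerFunction) {u : Linf} (hu : toL2 u ∈ H2)
    (h : ∀ g ∈ H2, ⟪(bd θ • (monomialInf 1 • g : L2) : L2), toL2 u⟫_ℂ = 0) :
    toL2 (backwardShift u) ∈ K θ := by
  rw [mem_K_iff]
  refine ⟨toL2_backwardShift_mem_H2 hu, fun g hg => ?_⟩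
  rw [toL2_backwardShift, smul_sub', inner_sub_right, smul_const', inner_smul_right,
    monomialInf_smul_monomial, Submodule.inner_right_of_mem_orthogonal (bd_smul_mem_H2 θ hg)
      (monomial_mem_H2_orthogonal (by norm_num)), mul_zero, sub_zero, inner_smul_eq,
    star_monomialInf, neg_neg, smul_smul_comm, h g hg]

lemma toL2_bd_mem_H2 (θ : InnerFunction) : toL2 (bd θ) ∈ H2 :=
  bd_smul_mem_H2 θ (monomial_mem_H2 le_rfl)

lemma backwardShift_bd_mem_K (θ : InnerFunction) : toL2 (backwardShift (bd θ)) ∈ K θ := by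
  refine toL2_backwardShift_mem_K θ (toL2_bd_mem_H2 θ) fun g hg => ?_
  rw [toL2, inner_bd_smul_bd_smul, ← inner_conj_symm, inner_monomial_smul, (mem_H2_iff' g).1 hg _
    (by norm_num), map_zero]

/-- The witness is the (n+1)-fold backward shift of θ, the analytic part of z̄^(n+1) θ. -/
lemma exists_bounded_mem_K (θ : InnerFunction) (n : ℕ) : ∃ u : Linf, toL2 u ∈ K θ ∧
    (monomialInf (-(n + 1)) • toL2 (bd θ) : L2) - toL2 u ∈ H2ᗮ := by
  have key (f : L2) (u : Linf) (k : ℤ) (hf : f = (monomialInf k • toL2 (bd θ) : L2))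
      (hu : f - toL2 u ∈ H2ᗮ) :
      (monomialInf (k - 1) • toL2 (bd θ) : L2) - toL2 (backwardShift u) ∈ H2ᗮ := by
    have e : (monomialInf (k - 1) • toL2 (bd θ) : L2) - toL2 (backwardShift u) =
        (monomialInf (-1) • (f - toL2 u) : L2) + ⟪monomial 0, toL2 u⟫_ℂ • monomial (-1) := by
      rw [toL2_backwardShift, hf, smul_sub', smul_sub', monomialInf_smul_smul, smul_const',
        monomialInf_smul_monomial, sub_eq_neg_add k 1, add_zero]
      abel
    rw [e]
    exact H2ᗮ.add_mem (monomialInf_smul_mem_H2_orthogonal (by norm_num) hu)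
      (H2ᗮ.smul_mem _ (monomial_mem_H2_orthogonal (by norm_num)))
  induction n with
  | zero =>
    refine ⟨_, backwardShift_bd_mem_K θ, ?_⟩
    simpa using key (toL2 (bd θ)) (bd θ) 0 (monomialInf_zero_smul _).symm (by simp)
  | succ n ih =>
    obtain ⟨u, hu, h⟩ := ih
    refine ⟨backwardShift u, toL2_backwardShift_mem_K θ (K_le_H2 θ hu) fun g hg => ?_, ?_⟩
    · exact ((mem_K_iff θ _).1 hu).2 _ (monomialInf_smul_mem_H2 (by norm_num) hg)
    · have := key _ u _ rfl h
      rwa [show (-(n + 1) - 1 : ℤ) = -((n + 1 : ℕ) + 1) by push_cast; ring] at this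

/-- A function in the model space orthogonal to all its bounded functions vanishes. -/
lemma eq_zero_of_forall_bounded (θ : InnerFunction) {f : L2} (hf : f ∈ K θ)
    (h : ∀ u : Linf, toL2 u ∈ K θ → ⟪toL2 u, f⟫_ℂ = 0) : f = 0 := by
  -- Orthogonality of f to the backward shifts of θ kills the negative coefficients of θ̄f. Hence f
  -- = θ(θ̄f) lies in θH² as well as in K_θ, and is orthogonal to itself.
  have hmem : (star (bd θ) • f : L2) ∈ H2 := by
    rw [mem_H2_iff']
    intro n hn
    obtain ⟨j, hj⟩ := Int.eq_ofNat_of_zero_le (show 0 ≤ -n - 1 by lia)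
    obtain ⟨u, hu, hr⟩ := exists_bounded_mem_K θ j
    rw [inner_smul_eq, star_star]
    have e : (bd θ • monomial n : L2) = (monomialInf (-(j + 1)) • toL2 (bd θ) : L2) - toL2 u
        + toL2 u := by
      rw [sub_add_cancel, smul_toL2_comm, toL2_monomialInf]
      congr 2
      lia
    rw [e, inner_add_left, h u hu, Submodule.inner_left_of_mem_orthogonal (K_le_H2 θ hf) hr,
      add_zero]
  rw [← inner_self_eq_zero (𝕜 := ℂ)]
  have := ((mem_K_iff θ f).1 hf).2 _ hmem
  rwa [bd_smul_star_bd_smul] at this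

/-- Only P_θ x is seen by K_θ, and the preceding lemma applies to it. -/
lemma inner_eq_zero_of_forall_bounded (θ : InnerFunction) {x : L2}
    (h : ∀ u : Linf, toL2 u ∈ K θ → ⟪toL2 u, x⟫_ℂ = 0) : ∀ k ∈ K θ, ⟪k, x⟫_ℂ = 0 := by
  have h0 : (P θ x : L2) = 0 := eq_zero_of_forall_bounded θ (P θ x).2 fun u hu => by
    rw [← h u hu]
    exact Submodule.inner_orthogonalProjectionOnto_eq_of_mem_left ⟨_, hu⟩ x
  intro k hk
  rw [← Submodule.inner_orthogonalProjectionOnto_eq_of_mem_left (K := K θ) ⟨k, hk⟩ x]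
  change ⟪k, (P θ x : L2)⟫_ℂ = 0
  rw [h0, inner_zero_right]

/-- The bounded functions in the model space. -/
def boundedK (θ : InnerFunction) : Submodule ℂ (K θ) where
  carrier := {f | ∃ u : Linf, toL2 u = f}
  zero_mem' := ⟨0, by rw [toL2, Lp.zero_smul]; rfl⟩
  add_mem' := by
    rintro f g ⟨u, hu⟩ ⟨v, hv⟩
    exact ⟨u + v, by rw [toL2_add, hu, hv]; rfl⟩
  smul_mem' := by
    rintro c f ⟨u, hu⟩
    exact ⟨c • u, by rw [toL2_const, hu]; rfl⟩

lemma dense_boundedK (θ : InnerFunction) : Dense (boundedK θ : Set (K θ)) := by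
  rw [Submodule.dense_iff_topologicalClosure_eq_top, Submodule.topologicalClosure_eq_top_iff,
    Submodule.eq_bot_iff]
  intro f hf
  exact Subtype.ext (eq_zero_of_forall_bounded θ f.2 fun u hu =>
    (Submodule.mem_orthogonal _ _).1 hf ⟨_, hu⟩ ⟨u, rfl⟩)

lemma conjL2_toL2 (θ : InnerFunction) (u : Linf) : conjL2 θ (toL2 u) =
    toL2 (bd θ • (monomialInf (-1) • star u : Linf) : Linf) := by
  rw [toL2_smul, toL2_smul, toL2_star]
  rfl

lemma conjL2_eq (θ : InnerFunction) (f : L2) :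
    conjL2 θ f = (bd θ • (monomialInf (-1) • star f : L2) : L2) := rfl

/-- The reproducing kernel of the model space at the origin. -/
def kernelZero (θ : InnerFunction) : Linf :=
  monomialInf 0 - conj ⟪monomial 0, toL2 (bd θ)⟫_ℂ • bd θ

lemma kernelZero_smul (θ : InnerFunction) (f : L2) :
    (kernelZero θ • f : L2) = f - conj ⟪monomial 0, toL2 (bd θ)⟫_ℂ • (bd θ • f : L2) := by
  rw [kernelZero, sub_smul', const_smul', monomialInf_zero_smul]

/-- The kernel is the image of the backward shift of θ under C_θ. -/
lemma kernelZero_mem_K (θ : InnerFunction) : toL2 (kernelZero θ) ∈ K θ := by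
  have e : toL2 (kernelZero θ) = conjL2 θ (toL2 (backwardShift (bd θ))) := by
    rw [conjL2_eq, toL2_backwardShift, star_smul_eq, star_monomialInf, monomialInf_smul_smul,
      star_sub', star_smul_const, ← toL2_star, star_monomial, neg_neg, neg_add_cancel,
      monomialInf_zero_smul, smul_sub', smul_const', neg_zero, smul_toL2_comm]
    rw [show (star (bd θ) • toL2 (bd θ) : L2) = monomial 0 from star_bd_smul_bd_smul θ _]
    exact kernelZero_smul θ _
  rw [e]
  exact conjL2_mem θ (backwardShift_bd_mem_K θ)

lemma star_kernelZero_smul (θ : InnerFunction) (f : L2) : (star (kernelZero θ) • f : L2) =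
    f - ⟪monomial 0, toL2 (bd θ)⟫_ℂ • (star (bd θ) • f : L2) := by
  have := star_smul_eq (kernelZero θ) (star f)
  rw [star_star] at this
  rw [← this, kernelZero_smul, star_sub', star_smul_const, star_smul_eq, star_star,
    Complex.conj_conj]

lemma star_backwardShift_smul (u : Linf) (f : L2) : (star (backwardShift u) • f : L2) =
    (monomialInf 1 • ((star u • f : L2) - conj ⟪monomial 0, toL2 u⟫_ℂ • f) : L2) := by
  have := star_smul_eq (backwardShift u) (star f)
  rw [star_star] at this
  rw [← this, backwardShift_smul, star_smul_eq, star_sub', star_smul_const, star_smul_eq,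
    star_star, star_monomialInf, neg_neg]

/-! ### The value at the origin of a nonconstant inner function -/

lemma toCircle_sub_ne_zero {w : ℂ} (hw : ‖w‖ < 1) (t : Torus) :
    (AddCircle.toCircle t : ℂ) - w ≠ 0 := by
  intro h
  rw [sub_eq_zero] at h
  rw [← h, Circle.norm_coe] at hw
  exact lt_irrefl _ hw

/-- Cauchy's formula on the unit circle. -/
lemma integral_cauchy {g : ℂ → ℂ} (hg : DifferentiableOn ℂ g (Metric.ball 0 1))
    (hc : ContinuousOn g (Metric.closedBall 0 1)) {w : ℂ} (hw : ‖w‖ < 1) :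
    ∫ t, g (AddCircle.toCircle t) *
      ((AddCircle.toCircle t : ℂ) / ((AddCircle.toCircle t : ℂ) - w)) ∂m = g w := by
  have h := Complex.circleIntegral_sub_inv_smul_of_differentiable_on_off_countable
    Set.countable_empty (mem_ball_zero_iff.2 hw) hc fun x hx =>
      hg.differentiableAt (Metric.isOpen_ball.mem_nhds hx.1)
  rw [circleIntegral] at h
  have e : ∀ x : ℝ, deriv (circleMap 0 1) x • ((circleMap 0 1 x - w)⁻¹ • g (circleMap 0 1 x)) =
      Complex.I * (g (AddCircle.toCircle (x : Torus)) * ((AddCircle.toCircle (x : Torus) : ℂ) /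
        ((AddCircle.toCircle (x : Torus) : ℂ) - w))) := by
    intro x
    have hx : (AddCircle.toCircle (x : Torus) : ℂ) = circleMap 0 1 x := by
      rw [AddCircle.toCircle_apply_mk, Circle.coe_exp, circleMap, zero_add, Complex.ofReal_one,
        one_mul]
      congr 3
      field_simp
    rw [deriv_circleMap, hx]
    simp only [smul_eq_mul, div_eq_mul_inv]
    ring
  simp only [e] at h
  rw [intervalIntegral.integral_const_mul] at h
  rw [AddCircle.integral_haarAddCircle, ← AddCircle.intervalIntegral_preimage (2 * π) 0, zero_add]
  have h2 := mul_left_cancel₀ Complex.I_ne_zero (h.trans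
    (show _ = Complex.I * ((2 * π : ℂ) * g w) by rw [smul_eq_mul]; ring))
  rw [h2, Complex.real_smul]
  push_cast
  have : (π : ℂ) ≠ 0 := Complex.ofReal_ne_zero.2 Real.pi_ne_zero
  field_simp

lemma continuous_cauchyKernel {w : ℂ} (hw : ‖w‖ < 1) : Continuous fun t : Torus =>
    (AddCircle.toCircle t : ℂ) / ((AddCircle.toCircle t : ℂ) - w) := by
  have h : Continuous fun t : Torus => (AddCircle.toCircle t : ℂ) :=
    continuous_subtype_val.comp AddCircle.continuous_toCircle
  exact h.div (h.sub continuous_const) (toCircle_sub_ne_zero hw)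

/-- Cauchy's formula for the boundary function of an inner function. -/
lemma integral_bdFun_cauchy (θ : InnerFunction) {w : ℂ} (hw : ‖w‖ < 1) :
    ∫ t, bdFun θ t * ((AddCircle.toCircle t : ℂ) / ((AddCircle.toCircle t : ℂ) - w)) ∂m =
      θ.toFun w := by
  obtain ⟨M, hM⟩ := θ.bounded
  have hmaps (n : ℕ) (z : ℂ) (hz : z ∈ Metric.closedBall (0 : ℂ) 1) :
      (rad n : ℂ) * z ∈ Metric.ball (0 : ℂ) 1 := by
    rw [mem_closedBall_zero_iff] at hz
    rw [mem_ball_zero_iff, norm_mul, Complex.norm_real, Real.norm_eq_abs, abs_of_pos (rad_pos n)]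
    exact (mul_le_of_le_one_right (rad_pos n).le hz).trans_lt (rad_lt n)
  have hcauchy (n : ℕ) := integral_cauchy (g := fun z => θ.toFun (rad n * z)) (w := w)
    (θ.differentiableOn.comp (by fun_prop) fun z hz =>
      hmaps n z (Metric.ball_subset_closedBall hz))
    (θ.differentiableOn.continuousOn.comp (by fun_prop) (hmaps n)) hw
  have hker := continuous_cauchyKernel hw
  obtain ⟨B, hB⟩ := (isCompact_range hker).isBounded.exists_norm_le
  have ht := tendsto_integral_of_dominated_convergence (μ := m) (fun _ => M * B)
    (F := fun n t => θ.toFun (rad n * (AddCircle.toCircle t : ℂ)) *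
      ((AddCircle.toCircle t : ℂ) / ((AddCircle.toCircle t : ℂ) - w)))
    (f := fun t => bdFun θ t * ((AddCircle.toCircle t : ℂ) / ((AddCircle.toCircle t : ℂ) - w)))
    (fun n => ((continuous_rad θ n).mul hker).aestronglyMeasurable) (integrable_const _)
    (fun n => Eventually.of_forall fun t => by
      rw [norm_mul]
      have h1 := hM _ (rad_mem n t)
      exact mul_le_mul h1 (hB _ ⟨t, rfl⟩) (norm_nonneg _) ((norm_nonneg _).trans h1))
    (by
      filter_upwards [bdFun_tendsto θ] with t h
      exact (h.comp rad_tendsto).mul_const _)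
  simp only [hcauchy] at ht
  have hwb : w ∈ Metric.ball (0 : ℂ) 1 := mem_ball_zero_iff.2 hw
  have hr : Tendsto (fun n => (rad n : ℂ) * w) atTop (𝓝 w) := by
    have h1 : Tendsto rad atTop (𝓝 1) := rad_tendsto.mono_right nhdsWithin_le_nhds
    simpa using ((Complex.continuous_ofReal.tendsto 1).comp h1).mul_const w
  have h2 := ((θ.differentiableOn.differentiableAt
    (Metric.isOpen_ball.mem_nhds hwb)).continuousAt.tendsto.comp hr)
  exact tendsto_nhds_unique ht h2

lemma inner_bd_self (θ : InnerFunction) : ⟪toL2 (bd θ), toL2 (bd θ)⟫_ℂ = 1 := by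
  rw [toL2, inner_bd_smul_bd_smul, inner_monomial_self]

/-- Nonconstancy is assumed in the disc; Cauchy's formula recovers the values there from the
boundary function. -/
lemma toL2_bd_ne_const {θ : InnerFunction} (hθ : θ.Nonconstant) (c : ℂ) :
    toL2 (bd θ) ≠ c • monomial 0 := by
  intro h
  have hae : ∀ᵐ t ∂m, bdFun θ t = c := by
    filter_upwards [coe_bd θ, coe_toL2 (bd θ), Lp.coeFn_smul c (monomial 0), coe_fourier 0]
      with t h1 h2 h3 h4
    rw [← h1, ← h2, h, h3, Pi.smul_apply, monomial, h4, fourier_zero, smul_eq_mul, mul_one]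
  have hval : ∀ w ∈ Metric.ball (0 : ℂ) 1, θ.toFun w = c := by
    intro w hw
    rw [mem_ball_zero_iff] at hw
    rw [← integral_bdFun_cauchy θ hw, ← integral_cauchy (g := fun _ => c)
      (differentiableOn_const c) continuousOn_const hw]
    refine integral_congr_ae ?_
    filter_upwards [hae] with t ht
    rw [ht]
  obtain ⟨w₁, h1, w₂, h2, hne⟩ := hθ
  exact hne ((hval w₁ h1).trans (hval w₂ h2).symm)

/-- With c the mean of θ, the quantity equals ‖θ − c‖², because ‖θ‖ = 1. -/
lemma one_sub_mean_mul_conj_ne_zero {θ : InnerFunction} (hθ : θ.Nonconstant) :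
    1 - conj ⟪monomial 0, toL2 (bd θ)⟫_ℂ * ⟪monomial 0, toL2 (bd θ)⟫_ℂ ≠ 0 := by
  set c := ⟪monomial 0, toL2 (bd θ)⟫_ℂ with hc
  intro h
  refine toL2_bd_ne_const hθ c ?_
  rw [← sub_eq_zero, ← inner_self_eq_zero (𝕜 := ℂ)]
  have h1 : ⟪toL2 (bd θ), monomial 0⟫_ℂ = conj c := by rw [hc, inner_conj_symm]
  simp only [inner_sub_left, inner_sub_right, inner_smul_left, inner_smul_right, h1, ← hc,
    inner_bd_self, inner_monomial_self]
  linear_combination h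

/-! ### Symbols orthogonal to products of functions in model spaces -/

lemma monomialInf_cancel (k : ℤ) (f : L2) :
    (monomialInf k • (monomialInf (-k) • f : L2) : L2) = f := by
  rw [monomialInf_smul_smul, add_neg_cancel, monomialInf_zero_smul]

/-- Elimination of y from the 2×2 system; below, (x, y) is (f, ᾱf) or (v, βv). -/
lemma sub_smul_eq_of_eq {M : Type*} [AddCommGroup M] [Module ℂ M] {a b : ℂ} {x y p q : M}
    (h₁ : x - a • y = p) (h₂ : y - b • x = q) : (1 - b * a) • x = p + a • q := by
  rw [← h₁, ← h₂]
  module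

/-- Taking for k the kernel and the backward shift of α controls f − aᾱf (after a factor z) and ᾱf −
āf, where a is the mean of α. Eliminating ᾱf isolates f. The factor z moves `H2ᗮ` only into
conj(H²). -/
lemma exists_eq_bd_smul_add_star {α : InnerFunction} (hα : α.Nonconstant) (β : InnerFunction)
    {f : L2} (h : ∀ k : Linf, toL2 k ∈ K α → ∃ y ∈ H2, ∃ r ∈ H2ᗮ,
      (star k • (monomialInf (-1) • f : L2) : L2) = (bd β • y : L2) + r) :
    ∃ v ∈ H2, ∃ w ∈ H2, f = (bd β • v : L2) + star w := by
  obtain ⟨v₁, hv₁, m₁, hm₁, e₁⟩ := h _ (kernelZero_mem_K α)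
  obtain ⟨v₂, hv₂, m₂, hm₂, e₂⟩ := h _ (backwardShift_bd_mem_K α)
  have hd := one_sub_mean_mul_conj_ne_zero hα
  rw [star_kernelZero_smul] at e₁
  rw [star_backwardShift_smul] at e₂
  set a := ⟪monomial 0, toL2 (bd α)⟫_ℂ
  have e₁' := congrArg (fun x : L2 => (monomialInf 1 • x : L2)) e₁
  simp only [smul_smul_comm (star (bd α)) (monomialInf (-1)), smul_const', smul_sub',
    monomialInf_cancel, Lp.add_smul, smul_smul_comm _ (bd β)] at e₁' e₂
  set d := 1 - conj a * a
  have key : f = d⁻¹ • (d • f) := (inv_smul_smul₀ hd f).symm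
  have e : d • f = (bd β • ((monomialInf 1 • v₁ : L2) + a • v₂) : L2) +
      ((monomialInf 1 • m₁ : L2) + a • m₂) := by
    rw [Lp.add_smul, smul_const', sub_smul_eq_of_eq e₁' e₂, smul_add, add_add_add_comm]
  refine ⟨d⁻¹ • ((monomialInf 1 • v₁ : L2) + a • v₂), H2.smul_mem _ (H2.add_mem
    (monomialInf_smul_mem_H2 (by norm_num) hv₁) (H2.smul_mem _ hv₂)),
    star (d⁻¹ • ((monomialInf 1 • m₁ : L2) + a • m₂)), ?_, ?_⟩
  · rw [star_smul_const, star_add', star_smul_const]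
    exact H2.smul_mem _ (H2.add_mem (star_shift_mem_H2_of_orthogonal hm₁)
      (H2.smul_mem _ (star_mem_H2_of_orthogonal hm₂)))
  · rw [star_star, smul_const', ← smul_add, ← e, ← key]

/-- Each gv lies in αH². Taking for g the kernel and the backward shift of β and eliminating βv puts
v itself in αH². -/
lemma exists_eq_bd_smul_of_bounded_mul {β : InnerFunction} (hβ : β.Nonconstant)
    (α : InnerFunction) {v : L2} (hv : v ∈ H2)
    (h : ∀ g k : Linf, toL2 g ∈ K β → toL2 k ∈ K α → ⟪toL2 k, (g • v : L2)⟫_ℂ = 0) :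
    ∃ y ∈ H2, v = (bd α • y : L2) := by
  have hdvd (g : Linf) (hg : toL2 g ∈ K β) : ∃ y ∈ H2, (g • v : L2) = (bd α • y : L2) :=
    exists_eq_bd_smul α (smul_mem_H2 (K_le_H2 β hg) hv)
      (inner_eq_zero_of_forall_bounded α fun k hk => h g k hg hk)
  obtain ⟨y₁, hy₁, e₁⟩ := hdvd _ (kernelZero_mem_K β)
  obtain ⟨y₂, hy₂, e₂⟩ := hdvd _ (backwardShift_bd_mem_K β)
  have hd := one_sub_mean_mul_conj_ne_zero hβ
  rw [kernelZero_smul] at e₁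
  rw [backwardShift_smul] at e₂
  set b := ⟪monomial 0, toL2 (bd β)⟫_ℂ
  have e₂' := congrArg (fun x : L2 => (monomialInf 1 • x : L2)) e₂
  simp only [monomialInf_cancel, smul_smul_comm _ (bd α)] at e₂'
  set d := 1 - conj b * b
  have key : v = d⁻¹ • (d • v) := (inv_smul_smul₀ hd v).symm
  have e : d • v = (bd α • (y₁ + conj b • (monomialInf 1 • y₂ : L2)) : L2) := by
    rw [Lp.add_smul, smul_const', ← sub_smul_eq_of_eq e₁ e₂', mul_comm b]
  refine ⟨d⁻¹ • (y₁ + conj b • (monomialInf 1 • y₂ : L2)), H2.smul_mem _ (H2.add_mem hy₁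
    (H2.smul_mem _ (monomialInf_smul_mem_H2 (by norm_num) hy₂))), ?_⟩
  rw [smul_const', ← e, ← key]

/-- If `φ` annihilates `z K_α K_β`, then `φ ∈ conj (α β H²) + H²`. -/
lemma exists_eq_star_add_of_forall {θ α β : InnerFunction} (hα : α.Nonconstant)
    (hβ : β.Nonconstant) (h : IsQuotient θ α β) {φ : L2}
    (H : ∀ g k : Linf, toL2 g ∈ K β → toL2 k ∈ K α →
      ⟪star φ, (monomialInf 1 • (k • toL2 g : L2) : L2)⟫_ℂ = 0) :
    ∃ v ∈ H2, ∃ w ∈ H2, φ = star (bd θ • v : L2) + w := by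
  obtain ⟨v, hv, w, hw, e⟩ := exists_eq_bd_smul_add_star hα β (f := star φ) fun k hk => by
    refine exists_eq_bd_smul_add β (inner_eq_zero_of_forall_bounded β fun g hg => ?_)
    rw [inner_smul_eq, star_star, inner_smul_eq, star_monomialInf, neg_neg, ← inner_conj_symm,
      H g k hg hk, map_zero]
  obtain ⟨y, hy, rfl⟩ := exists_eq_bd_smul_of_bounded_mul hβ α hv fun g k hg hk => by
    -- Testing with C_β g = β z̄ ḡ in place of g cancels both z and β, leaving ⟪v, k ḡ⟫ = 0, that
    -- is, gv ⊥ k. The w-part drops out because z k C_β g is in zH².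
    have hg' : conjL2 β (toL2 g) ∈ K β := conjL2_mem β hg
    have h1 := H _ k (by rwa [← conjL2_toL2]) hk
    rw [← conjL2_toL2, e, inner_add_left] at h1
    have h2 : ⟪star w, (monomialInf 1 • (k • conjL2 β (toL2 g) : L2) : L2)⟫_ℂ = 0 := by
      rw [← inner_star_star, star_star]
      exact Submodule.inner_left_of_mem_orthogonal hw
        (star_shift_mem_H2_orthogonal (smul_mem_H2 (K_le_H2 α hk) (K_le_H2 β hg')))
    rw [h2, add_zero, conjL2_eq, smul_smul_comm k, smul_smul_comm _ (bd β), inner_bd_smul_bd_smul,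
      smul_smul_comm k, monomialInf_cancel, ← toL2_star, smul_toL2_comm] at h1
    rw [inner_smul_eq, ← inner_conj_symm, h1, map_zero]
  refine ⟨y, hy, w, hw, ?_⟩
  rw [← star_star φ, e, star_add', star_star, smul_smul_comm, bd_smul_bd θ α β h]

/-! ### Symbols of asymmetric truncated Toeplitz operators -/

/-- Moving φ onto the bounded v gives a pairing continuous in f, even though f ↦ φf need not be. -/
lemma inner_toL2_eq {F f φ : L2} (v : Linf) (hF : ⇑F =ᵐ[m] fun t => φ t * f t) :
    ⟪toL2 v, F⟫_ℂ = ⟪(v • star φ : L2), f⟫_ℂ := by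
  rw [inner_def', inner_def']
  refine integral_congr_ae ?_
  filter_upwards [hF, coe_toL2 v, coe_smul v (star φ), coe_star φ] with t h1 h2 h3 h4
  rw [h1, h2, h3, h4, map_mul, Complex.conj_conj]
  ring

lemma smul_ae_mul_toL2 (u : Linf) (φ : L2) :
    ⇑(u • φ : L2) =ᵐ[m] fun t => φ t * toL2 u t := by
  filter_upwards [coe_smul u φ, coe_toL2 u] with t h1 h2
  rw [h1, h2, mul_comm]

lemma inner_toL2_smul (u v : Linf) (φ : L2) :
    ⟪toL2 v, (u • φ : L2)⟫_ℂ = ⟪(v • star φ : L2), toL2 u⟫_ℂ :=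
  inner_toL2_eq v (smul_ae_mul_toL2 u φ)

lemma inner_P {α : InnerFunction} {k : L2} (hk : k ∈ K α) (x : L2) :
    ⟪k, (P α x : L2)⟫_ℂ = ⟪k, x⟫_ℂ :=
  Submodule.inner_orthogonalProjectionOnto_eq_of_mem_left ⟨k, hk⟩ x

lemma P_eq_self {α : InnerFunction} (k : K α) : P α k = k :=
  Submodule.orthogonalProjectionOnto_mem_subspace_eq_self k

lemma P_eq_zero {α : InnerFunction} {x : L2} (h : ∀ k ∈ K α, ⟪k, x⟫_ℂ = 0) : P α x = 0 :=
  Submodule.orthogonalProjectionOnto_apply_of_mem_orthogonal ((Submodule.mem_orthogonal _ _).2 h)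

/-- A bounded operator has symbol `φ` if and only if it has the corresponding matrix coefficients
at bounded functions. -/
lemma isATTO_iff {θ α : InnerFunction} {φ : L2} {A : K θ →L[ℂ] K α} :
    IsATTO θ α φ A ↔ ∀ (u v : Linf) (hu : toL2 u ∈ K θ), toL2 v ∈ K α →
      ⟪toL2 v, (A ⟨toL2 u, hu⟩ : L2)⟫_ℂ = ⟪toL2 v, (u • φ : L2)⟫_ℂ := by
  constructor
  · intro hA u v hu hv
    have hae := smul_ae_mul_toL2 u φ
    have hmem : MemLp (fun t => φ t * toL2 u t) 2 m := (Lp.memLp (u • φ : L2)).ae_eq hae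
    have e : hmem.toLp = (u • φ : L2) := Lp.ext (hmem.coeFn_toLp.trans hae.symm)
    rw [hA ⟨toL2 u, hu⟩ hmem, inner_P hv, e]
  · intro hA f hf
    have key (v : Linf) (hv : toL2 v ∈ K α) :
        ⟪toL2 v, (A f : L2)⟫_ℂ = ⟪(v • star φ : L2), (f : L2)⟫_ℂ := by
      refine congrFun (Continuous.ext_on (dense_boundedK θ)
        (f := fun f : K θ => ⟪toL2 v, (A f : L2)⟫_ℂ)
        (g := fun f : K θ => ⟪(v • star φ : L2), (f : L2)⟫_ℂ) (by fun_prop) (by fun_prop) ?_) f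
      rintro ⟨_, hu⟩ ⟨u, rfl⟩
      exact (hA u v hu hv).trans (inner_toL2_smul u v φ)
    have h0 : P α (hf.toLp - (A f : L2)) = 0 :=
      P_eq_zero (inner_eq_zero_of_forall_bounded α fun v hv => by
        rw [inner_sub_right, key v hv, inner_toL2_eq v hf.coeFn_toLp, sub_self])
    rw [map_sub, P_eq_self, sub_eq_zero] at h0
    exact h0.symm

/-- The pairing is ⟪θ v x, u⟫ with vx ∈ H². -/
lemma inner_toL2_smul_star_eq_zero {θ : InnerFunction} {u v : Linf} (hu : toL2 u ∈ K θ)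
    (hv : toL2 v ∈ H2) {x : L2} (hx : x ∈ H2) :
    ⟪toL2 v, (u • star (bd θ • x : L2) : L2)⟫_ℂ = 0 := by
  rw [inner_toL2_smul, star_star, smul_smul_comm]
  exact ((mem_K_iff θ _).1 hu).2 _ (smul_mem_H2 hv hx)

lemma inner_smul_bd_smul_eq_zero {α : InnerFunction} {u : Linf} (hu : toL2 u ∈ H2) {k : L2}
    (hk : k ∈ K α) {y : L2} (hy : y ∈ H2) : ⟪k, (u • (bd α • y : L2) : L2)⟫_ℂ = 0 := by
  rw [smul_smul_comm, ← inner_conj_symm, ((mem_K_iff α k).1 hk).2 _ (smul_mem_H2 hu hy), map_zero]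

/-- Changing the symbol by an element of `conj (θ H²) + α H²` does not change the operator. -/
lemma IsATTO.of_sub_eq {θ α : InnerFunction} {φ φ' : L2} {A : K θ →L[ℂ] K α}
    (hA : IsATTO θ α φ A) {x y : L2} (hx : x ∈ H2) (hy : y ∈ H2)
    (e : φ = φ' + (star (bd θ • x : L2) + (bd α • y : L2))) : IsATTO θ α φ' A := by
  rw [isATTO_iff] at hA ⊢
  intro u v hu hv
  rw [hA u v hu hv, e, Lp.add_smul, Lp.add_smul, inner_add_right, inner_add_right,
    inner_toL2_smul_star_eq_zero hu (K_le_H2 α hv) hx,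
    inner_smul_bd_smul_eq_zero (K_le_H2 θ hu) hv hy, add_zero, add_zero]

lemma exists_eq_add_bd_smul (α : InnerFunction) {x : L2} (hx : x ∈ H2) :
    ∃ y ∈ H2, x = (P α x : L2) + (bd α • y : L2) := by
  obtain ⟨y, hy, e⟩ := exists_eq_bd_smul α (x := x - P α x)
    (H2.sub_mem hx (K_le_H2 α (P α x).2)) fun k hk => by
      rw [inner_sub_right, inner_P hk, sub_self]
  exact ⟨y, hy, by rw [← e, add_sub_cancel]⟩

/-- A continuous map between model spaces vanishes if its matrix coefficients at bounded functions
do. -/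
lemma eq_zero_of_forall_bounded_inner {β α : InnerFunction} {T : K β → K α} (hT : Continuous T)
    (h : ∀ (u v : Linf) (hu : toL2 u ∈ K β), toL2 v ∈ K α →
      ⟪toL2 v, (T ⟨toL2 u, hu⟩ : L2)⟫_ℂ = 0) (g : K β) : T g = 0 := by
  refine congrFun (Continuous.ext_on (dense_boundedK β) hT
    (continuous_const (y := (0 : K α))) ?_) g
  rintro ⟨_, hu⟩ ⟨u, rfl⟩
  exact Subtype.ext (eq_zero_of_forall_bounded α (T _).2 fun v hv => h u v hu hv)

lemma IsQuotient.symm {θ α β : InnerFunction} (h : IsQuotient θ α β) : IsQuotient θ β α :=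
  fun w hw => (h w hw).trans (mul_comm _ _)

/-- Multiplication by `α` as an operator from `K_β` to `K_θ`, where `θ = α β`. -/
def mulK {θ α β : InnerFunction} (h : IsQuotient θ α β) (g : K β) : K θ :=
  ⟨(bd α • (g : L2) : L2), bd_smul_mem_K h g.2⟩

/-- The inclusion of `K_α` in `K_θ`, where `θ = α β`. -/
def inclK {θ α β : InnerFunction} (h : IsQuotient θ α β) (g : K α) : K θ :=
  ⟨g, K_le_K h g.2⟩

lemma coe_inclK {θ α β : InnerFunction} (h : IsQuotient θ α β) (g : K α) :
    (inclK h g : L2) = g := by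
  unfold inclK
  rfl

lemma coe_mulK {θ α β : InnerFunction} (h : IsQuotient θ α β) (g : K β) :
    (mulK h g : L2) = (bd α • (g : L2) : L2) := by
  unfold mulK
  rfl

lemma continuous_mulK {θ α β : InnerFunction} (h : IsQuotient θ α β) : Continuous (mulK h) :=
  ((continuous_smul' _).comp continuous_subtype_val).subtype_mk _

lemma continuous_inclK {θ α β : InnerFunction} (h : IsQuotient θ α β) : Continuous (inclK h) :=
  continuous_subtype_val.subtype_mk _

/-- An operator vanishing on `K_β` has a symbol in `conj (β K_α)`, and conversely. -/
lemma exists_symbol_star_iff {θ α β : InnerFunction} (hα : α.Nonconstant) (hβ : β.Nonconstant)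
    (h : IsQuotient θ α β) {A : K θ →L[ℂ] K α} (hA : A ∈ ATTOs θ α) :
    (∀ g : K β, A (inclK h.symm g) = 0) ↔
      ∃ φ : L2, (∃ k ∈ K α, φ = star (bd β • k : L2)) ∧ IsATTO θ α φ A := by
  constructor
  · intro h0
    obtain ⟨φ, hφ⟩ := hA
    have hφ' := isATTO_iff.1 hφ
    obtain ⟨v, hv, w, hw, e⟩ := exists_eq_star_add_of_forall hα hβ h
      (φ := (star (bd α) • φ : L2)) fun g k hg hk => by
        have h1 := hφ' g _ (K_le_K h.symm hg) (by
          have := conjL2_mem α hk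
          rwa [conjL2_toL2] at this)
        -- The test vector is C_α k = α z̄ k̄, so the vanishing coefficient is ∫ ᾱφ z k g.
        rw [show A ⟨toL2 g, _⟩ = 0 from h0 ⟨_, hg⟩, inner_toL2_smul, smul_smul', smul_smul',
          ZeroMemClass.coe_zero, inner_zero_right] at h1
        rw [star_smul_eq, star_star, inner_smul_eq, inner_smul_eq, star_monomialInf,
          smul_smul_comm (star k), smul_smul_comm (star k), smul_smul_comm _ (bd α)]
        exact h1.symm
    -- Here φ = conj(βv) + αw. Replacing v by P_α v costs conj(βαx) = conj(θx), a null symbol, and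
    -- αw is null too.
    obtain ⟨x, hx, ex⟩ := exists_eq_add_bd_smul α hv
    refine ⟨_, ⟨P α v, (P α v).2, rfl⟩, hφ.of_sub_eq hx hw ?_⟩
    have e' : φ = (bd α • (star (bd θ • v : L2) + w) : L2) := by
      rw [← e, bd_smul_star_bd_smul]
    have e'' : (bd α • star (bd θ • v : L2) : L2) = star (bd β • v : L2) := by
      rw [bd_smul_bd θ α β h, star_smul_eq (bd α), bd_smul_star_bd_smul]
    rw [e', Lp.add_smul, e'']
    nth_rewrite 1 [ex]
    rw [Lp.add_smul, star_add', smul_smul_comm (bd β), ← bd_smul_bd θ α β h, add_assoc]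
  · rintro ⟨_, ⟨k, hk, rfl⟩, hA⟩
    refine eq_zero_of_forall_bounded_inner (A.continuous.comp (continuous_inclK _)) ?_
    intro u v hu hv
    exact (isATTO_iff.1 hA u v (K_le_K h.symm hu) hv).trans
      (inner_toL2_smul_star_eq_zero hu (K_le_H2 α hv) (K_le_H2 α hk))

/-- An operator vanishing on `α K_β` has a symbol in `K_α`, and conversely. -/
lemma exists_symbol_mem_K_iff {θ α β : InnerFunction} (hα : α.Nonconstant) (hβ : β.Nonconstant)
    (h : IsQuotient θ α β) {A : K θ →L[ℂ] K α} (hA : A ∈ ATTOs θ α) :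
    (∀ g : K β, A (mulK h g) = 0) ↔ ∃ φ ∈ K α, IsATTO θ α φ A := by
  constructor
  · intro h0
    obtain ⟨φ, hφ⟩ := hA
    have hφ' := isATTO_iff.1 hφ
    obtain ⟨v, hv, w, hw, e⟩ := exists_eq_star_add_of_forall hα hβ h (φ := φ) fun g k hg hk => by
      have hg' := bd_smul_mem_K h hg
      rw [← toL2_smul] at hg'
      have h1 := hφ' _ _ hg' (by
        have := conjL2_mem α hk
        rwa [conjL2_toL2] at this)
      have e0 : A ⟨_, hg'⟩ = 0 := by
        rw [← h0 ⟨_, hg⟩]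
        congr 1
        exact Subtype.ext (toL2_smul _ _)
      -- The α in αg cancels the α in C_α k, so φ itself annihilates z k g.
      rw [e0, inner_toL2_smul, smul_smul', smul_smul', toL2_smul (bd α) g, inner_bd_smul_bd_smul,
        ZeroMemClass.coe_zero, inner_zero_right] at h1
      rw [inner_smul_eq, inner_smul_eq, star_monomialInf, smul_smul_comm (star k)]
      exact h1.symm
    obtain ⟨x, hx, ex⟩ := exists_eq_add_bd_smul α hw
    refine ⟨_, (P α w).2, hφ.of_sub_eq hv hx ?_⟩
    rw [e]
    nth_rewrite 1 [ex]
    abel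
  · rintro ⟨φ, hφ, hA⟩
    refine eq_zero_of_forall_bounded_inner (A.continuous.comp (continuous_mulK _)) ?_
    intro u v hu hv
    have hu' := bd_smul_mem_K h hu
    rw [← toL2_smul] at hu'
    have e0 : mulK h ⟨_, hu⟩ = ⟨_, hu'⟩ := Subtype.ext (toL2_smul _ _).symm
    rw [e0, isATTO_iff.1 hA _ v hu' hv, smul_smul', smul_smul_comm]
    exact inner_smul_bd_smul_eq_zero (K_le_H2 β hu) hv (K_le_H2 α hφ)

/-! ### Conjugations -/

lemma inner_conjL2_comm (θ : InnerFunction) (f g : L2) :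
    ⟪conjL2 θ f, g⟫_ℂ = ⟪conjL2 θ g, f⟫_ℂ := by
  simp only [conjL2_eq, inner_smul_eq', ← smul_smul']
  exact inner_star_smul_comm _ _ _

lemma conjL2_conjL2 (θ : InnerFunction) (f : L2) : conjL2 θ (conjL2 θ f) = f := by
  rw [conjL2_eq, conjL2_eq, star_smul_eq, star_smul_eq, star_star, star_monomialInf,
    smul_smul_comm (star (bd θ)), monomialInf_smul_smul, neg_neg, neg_add_cancel,
    monomialInf_zero_smul, bd_smul_star_bd_smul]

lemma continuous_star_L2 : Continuous fun f : L2 => star f :=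
  (Isometry.of_dist_eq fun f g => by
    rw [dist_eq_norm, dist_eq_norm, ← star_sub', norm_eq_sqrt_re_inner (𝕜 := ℂ), inner_star_star,
      ← norm_eq_sqrt_re_inner]).continuous

lemma continuous_conjL2 (θ : InnerFunction) : Continuous (conjL2 θ) :=
  (continuous_smul' _).comp ((continuous_smul' _).comp continuous_star_L2)

lemma coe_C (θ : InnerFunction) (f : K θ) : (C θ f : L2) = conjL2 θ (f : L2) := rfl

lemma C_C (θ : InnerFunction) (f : K θ) : C θ (C θ f) = f := Subtype.ext (conjL2_conjL2 θ f)

/-- The matrix of an asymmetric truncated Toeplitz operator composed with a conjugation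
`f ↦ γ z̄ f̄` is symmetric on `K_α`. -/
lemma inner_apply_conjL2_comm {θ α : InnerFunction} {A : K θ →L[ℂ] K α} (hA : A ∈ ATTOs θ α)
    (γ : InnerFunction) (hγ : ∀ g : K α, conjL2 γ (g : L2) ∈ K θ) (f g : K α) :
    ⟪f, A ⟨_, hγ g⟩⟫_ℂ = ⟪g, A ⟨_, hγ f⟩⟫_ℂ := by
  obtain ⟨φ, hφ⟩ := hA
  rw [isATTO_iff] at hφ
  have hc : Continuous fun g : K α => (⟨_, hγ g⟩ : K θ) :=
    ((continuous_conjL2 γ).comp continuous_subtype_val).subtype_mk _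
  -- The coefficient depends on u and v only through uv; density then frees one argument at a time.
  have coeff (u v : Linf) (hu : toL2 u ∈ K α) (hv : toL2 v ∈ K α) :
      ⟪toL2 u, (A ⟨_, hγ ⟨_, hv⟩⟩ : L2)⟫_ℂ =
        ⟪(u • toL2 v : L2), (monomialInf (-1) • (bd γ • φ : L2) : L2)⟫_ℂ := by
    have hv' := hγ ⟨_, hv⟩
    have e : (⟨_, hγ ⟨_, hv⟩⟩ : K θ) = ⟨_, by rwa [conjL2_toL2] at hv'⟩ :=
      Subtype.ext (conjL2_toL2 γ v)
    rw [e, hφ _ u _ hu, smul_smul', smul_smul', smul_toL2_comm, inner_smul_eq' v,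
      smul_smul_comm (bd γ) (monomialInf (-1)), smul_smul_comm (star v) (monomialInf (-1)),
      smul_smul_comm (star v) (bd γ)]
  have hb (u : Linf) (hu : toL2 u ∈ K α) (g : K α) :
      ⟪toL2 u, (A ⟨_, hγ g⟩ : L2)⟫_ℂ = ⟪(g : L2), (A ⟨_, hγ ⟨_, hu⟩⟩ : L2)⟫_ℂ := by
    refine congrFun (Continuous.ext_on (dense_boundedK α)
      (f := fun g : K α => ⟪toL2 u, (A ⟨_, hγ g⟩ : L2)⟫_ℂ)
      (g := fun g : K α => ⟪(g : L2), (A ⟨_, hγ ⟨_, hu⟩⟩ : L2)⟫_ℂ) (by fun_prop) (by fun_prop) ?_) g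
    rintro ⟨_, hv⟩ ⟨v, rfl⟩
    exact (coeff u v hu hv).trans ((congrArg (⟪·, _⟫_ℂ) (smul_toL2_comm u v)).trans
      (coeff v u hv hu).symm)
  rw [Submodule.coe_inner, Submodule.coe_inner]
  refine congrFun (Continuous.ext_on (dense_boundedK α)
    (f := fun f : K α => ⟪(f : L2), (A ⟨_, hγ g⟩ : L2)⟫_ℂ)
    (g := fun f : K α => ⟪(g : L2), (A ⟨_, hγ f⟩ : L2)⟫_ℂ) (by fun_prop) (by fun_prop) ?_) f
  rintro ⟨_, hu⟩ ⟨u, rfl⟩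
  exact hb u hu g

lemma exists_eq_inclK_add_mulK {θ α β : InnerFunction} (h : IsQuotient θ α β) (f : K θ) :
    ∃ g : K β, f = inclK h (P α f) + mulK h g := by
  obtain ⟨y, hy, e⟩ := exists_eq_add_bd_smul α (K_le_H2 θ f.2)
  refine ⟨⟨y, (mem_K_iff β y).2 ⟨hy, fun x hx => ?_⟩⟩, Subtype.ext ?_⟩
  swap
  · rw [Submodule.coe_add, coe_inclK, coe_mulK]
    exact e
  -- The remainder αy is in K_θ, hence orthogonal to αβH²; cancelling α gives y ⊥ βH².
  have h1 := ((mem_K_iff θ _).1 ((K θ).sub_mem f.2 (K_le_K h (P α f).2))).2 x hx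
  rwa [bd_smul_bd θ α β h, sub_eq_of_eq_add' e, inner_bd_smul_bd_smul] at h1

lemma inner_mulK_eq_zero {θ α β : InnerFunction} (h : IsQuotient θ α β) {k : L2} (hk : k ∈ K α)
    (g : K β) : ⟪k, (mulK h g : L2)⟫_ℂ = 0 := by
  rw [coe_mulK, ← inner_conj_symm, ((mem_K_iff α k).1 hk).2 _ (K_le_H2 β g.2), map_zero]

lemma P_mulK {θ α β : InnerFunction} (h : IsQuotient θ α β) (g : K β) :
    P α (mulK h g : L2) = 0 :=
  P_eq_zero fun _ hk => inner_mulK_eq_zero h hk g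

/-- A criterion for `A D = D A^* P_α`, where `D` is a conjugation of `K_θ`. -/
lemma apply_conj_eq_iff {θ α β : InnerFunction} (h : IsQuotient θ α β) {A : K θ →L[ℂ] K α}
    {D : K θ → K θ} (hadd : ∀ f g, D (f + g) = D f + D g)
    (hD : ∀ f g, ⟪D f, g⟫_ℂ = ⟪D g, f⟫_ℂ)
    (hA : ∀ f g : K α, ⟪f, A (D (inclK h g))⟫_ℂ = ⟪g, A (D (inclK h f))⟫_ℂ) :
    (∀ f : K θ, (A (D f) : L2) = D (A.adjoint (P α f))) ↔ ∀ g : K β, A (D (mulK h g)) = 0 := by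
  have hD0 : D 0 = 0 := by
    have := hadd 0 0
    rwa [add_zero, left_eq_add] at this
  constructor
  · intro H g
    refine Subtype.ext ?_
    rw [H, P_mulK, map_zero, hD0, ZeroMemClass.coe_zero, ZeroMemClass.coe_zero]
  · intro H f
    -- Vanishing on α K_β makes A D factor through P_α, so symmetry on K_α extends to K_θ.
    have hred (f : K θ) : A (D f) = A (D (inclK h (P α f))) := by
      obtain ⟨g, hg⟩ := exists_eq_inclK_add_mulK h f
      nth_rewrite 1 [hg]
      rw [hadd, map_add, H, add_zero]
    rw [← coe_inclK h]
    refine congrArg Subtype.val (ext_inner_left ℂ fun u => ?_)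
    have h1 : ⟪u, inclK h (A (D f))⟫_ℂ = ⟪P α u, A (D f)⟫_ℂ := by
      rw [Submodule.coe_inner, Submodule.coe_inner, coe_inclK, ← inner_conj_symm, ← inner_P (A (D f)).2, inner_conj_symm]
    rw [h1, hred, hA, ← hred u, ← inner_conj_symm (𝕜 := ℂ) u, hD, inner_conj_symm (𝕜 := ℂ) (A.adjoint (P α f)),
      ContinuousLinearMap.adjoint_inner_left]

/-- In θ z̄ conj(αg), the factor α of θ cancels ᾱ. -/
lemma C_mulK {θ α β : InnerFunction} (h : IsQuotient θ α β) (g : K β) :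
    C θ (mulK h g) = inclK h.symm (C β g) := by
  refine Subtype.ext ?_
  rw [coe_inclK, coe_C, coe_C, coe_mulK, conjL2_eq, conjL2_eq, star_smul_eq, bd_smul_bd θ α β h, smul_smul_comm (bd β),
    smul_smul_comm (bd β), smul_smul_comm (monomialInf (-1)), bd_smul_star_bd_smul,
    smul_smul_comm (bd β)]

lemma conjPair_eq {θ α β : InnerFunction} (h : IsQuotient θ α β) (g₁ : K α) (g₂ : K β) :
    conjPair h (inclK h g₁ + mulK h g₂) = inclK h (C α g₁) + mulK h (C β g₂) :=
  Subtype.ext (by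
    rw [Submodule.coe_add, coe_inclK, coe_mulK]
    exact conjPair_apply h _ g₁ g₂ (by rw [Submodule.coe_add, coe_inclK, coe_mulK]))

lemma inclK_add {θ α β : InnerFunction} (h : IsQuotient θ α β) (f g : K α) :
    inclK h (f + g) = inclK h f + inclK h g := Subtype.ext (by
    simp only [Submodule.coe_add, coe_inclK])

lemma mulK_add {θ α β : InnerFunction} (h : IsQuotient θ α β) (f g : K β) :
    mulK h (f + g) = mulK h f + mulK h g := Subtype.ext (by
    simp only [Submodule.coe_add, coe_mulK, Lp.add_smul])

lemma conjPair_inclK {θ α β : InnerFunction} (h : IsQuotient θ α β) (g : K α) :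
    conjPair h (inclK h g) = inclK h (C α g) := by
  have h0 : mulK h (0 : K β) = 0 := by
    have := mulK_add h (0 : K β) 0
    rwa [add_zero, left_eq_add] at this
  have := conjPair_eq h g 0
  rwa [map_zero, h0, add_zero, add_zero] at this

lemma conjPair_mulK {θ α β : InnerFunction} (h : IsQuotient θ α β) (g : K β) :
    conjPair h (mulK h g) = mulK h (C β g) := by
  have h0 : inclK h (0 : K α) = 0 := by
    have := inclK_add h (0 : K α) 0
    rwa [add_zero, left_eq_add] at this
  have := conjPair_eq h 0 g
  rwa [map_zero, h0, zero_add, zero_add] at this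

lemma conjPair_add {θ α β : InnerFunction} (h : IsQuotient θ α β) (f g : K θ) :
    conjPair h (f + g) = conjPair h f + conjPair h g := by
  obtain ⟨f₂, hf⟩ := exists_eq_inclK_add_mulK h f
  obtain ⟨g₂, hg⟩ := exists_eq_inclK_add_mulK h g
  generalize P α f = f₁ at hf
  generalize P α g = g₁ at hg
  subst hf hg
  rw [add_add_add_comm, ← inclK_add, ← mulK_add, conjPair_eq, conjPair_eq, conjPair_eq, map_add,
    map_add, inclK_add, mulK_add]
  abel

lemma inner_inclK_add_mulK {θ α β : InnerFunction} (h : IsQuotient θ α β) (f₁ g₁ : K α)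
    (f₂ g₂ : K β) :
    ⟪inclK h f₁ + mulK h f₂, inclK h g₁ + mulK h g₂⟫_ℂ = ⟪f₁, g₁⟫_ℂ + ⟪f₂, g₂⟫_ℂ := by
  have h1 := inner_mulK_eq_zero h f₁.2 g₂
  have h2 := inner_mulK_eq_zero h g₁.2 f₂
  rw [← inner_conj_symm, map_eq_zero] at h2
  rw [Submodule.coe_inner, Submodule.coe_inner, Submodule.coe_inner, Submodule.coe_add,
    Submodule.coe_add, inner_add_left, inner_add_right, inner_add_right, coe_inclK, coe_inclK,
    h1, h2, coe_mulK, coe_mulK, inner_bd_smul_bd_smul, add_zero, zero_add]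

lemma inner_C_comm (θ : InnerFunction) (f g : K θ) : ⟪C θ f, g⟫_ℂ = ⟪C θ g, f⟫_ℂ :=
  inner_conjL2_comm θ f g

lemma inner_conjPair_comm {θ α β : InnerFunction} (h : IsQuotient θ α β) (f g : K θ) :
    ⟪conjPair h f, g⟫_ℂ = ⟪conjPair h g, f⟫_ℂ := by
  obtain ⟨f₂, hf⟩ := exists_eq_inclK_add_mulK h f
  obtain ⟨g₂, hg⟩ := exists_eq_inclK_add_mulK h g
  generalize P α f = f₁ at hf
  generalize P α g = g₁ at hg
  subst hf hg
  rw [conjPair_eq, conjPair_eq, inner_inclK_add_mulK, inner_inclK_add_mulK, inner_C_comm α f₁,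
    inner_C_comm β f₂]

end ATTO

end

theorem corollary5p4 (θ α β : InnerFunction)
    (hθ : θ.Nonconstant) (hα : α.Nonconstant) (hβ : β.Nonconstant)
    (h : IsQuotient θ α β)
    (A : K θ →L[ℂ] K α) (hA : A ∈ ATTOs θ α) :
    ((∀ f : K θ, (A (C θ f) : L2) = C θ (A.adjoint (P α f))) ↔
      ∃ φ : L2, (∃ k ∈ K α, φ = star (bd β • k : L2)) ∧ IsATTO θ α φ A) ∧
    ((∀ f : K θ, (A (conjPair h f) : L2) = conjPair h (A.adjoint (P α f))) ↔
      ∃ φ ∈ K α, IsATTO θ α φ A) := by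
  have hθα (g : K α) : conjL2 θ (g : L2) ∈ K θ := conjL2_mem θ (K_le_K h g.2)
  have hαα (g : K α) : conjL2 α (g : L2) ∈ K θ := K_le_K h (conjL2_mem α g.2)
  have hCθ (g : K α) : C θ (inclK h g) = ⟨_, hθα g⟩ := Subtype.ext (by rw [coe_C, coe_inclK])
  have hCα (g : K α) : conjPair h (inclK h g) = ⟨_, hαα g⟩ :=
    Subtype.ext (by rw [conjPair_inclK, coe_inclK, coe_C])
  constructor
  · rw [apply_conj_eq_iff h (D := C θ) (map_add _) (inner_C_comm θ) fun f g => by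
        rw [hCθ, hCθ]
        exact inner_apply_conjL2_comm hA θ hθα f g,
      ← exists_symbol_star_iff hα hβ h hA]
    simp only [C_mulK]
    -- C_β is an involution, so C_β g runs over all of K_β.
    exact ⟨fun H g => by simpa only [C_C] using H (C β g), fun H g => H _⟩
  · rw [apply_conj_eq_iff h (conjPair_add h) (inner_conjPair_comm h) fun f g => by
        rw [hCα, hCα]
        exact inner_apply_conjL2_comm hA α hαα f g,
      ← exists_symbol_mem_K_iff hα hβ h hA]
    simp only [conjPair_mulK]
    exact ⟨fun H g => by simpa only [C_C] using H (C β g), fun H g => H _⟩
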